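/- **Setting.** Let $X=\mathbb R^{M\times N}$ with the $\ell^2$ scalar product and let $Y=X^2$, with elements written pixelwise as $q=(q_x)_x$, $q_x\in\mathbb R^2$, $\|q\|^2=\sum_x|q_x|^2$ ($|\cdot|$ Euclidean). Let $\nabla:X\to Y$ be the forward difference gradient (differences across the last row or column are set to $0$), and $\mathrm{Div}=-\nabla^*$. Let $K$ be a linear map from $X$ to a finite-dimensional inner product space, $z$ an element of that space, $\mu\ge 0$, $\alpha>0$, $f=K^*z$, and suppose that $H=\mu\nabla^*\nabla+K^*K$ is positive definite. Put $D(u)=\tfrac12\|Ku-z\|^2+\tfrac\mu2\|\nabla u\|^2$ and $\|p\|_1=\sum_x|p_x|$. The primal problem is $\min_u D(u)+\alpha\|\nabla u\|_1$ (isotropic TV). The dual problem is to maximise $-d$, where $$d(\lambda)=\tfrac12\langle H^{-1}(\mathrm{Div}\lambda+f),\mathrm{Div}\lambda+f\rangle-\tfrac12\|z\|^2+\mathcal I_{\{|\lambda_x|\le\alpha\ \forall x\}}(\lambda),$$ and $\mathcal X^I$ is its solution set. Let $\mathcal P_\alpha(q)_x=q_x/\max(1,|q_x|/\alpha)$, $S_\tau(q)_x=\max(0,1-\tau/|q_x|)\,q_x$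 (equal to $0$ where $q_x=0$), and $$\Phi_k(u)=D(u)+\alpha\|p\|_1+\langle\lambda^k,\nabla u-p\rangle+\tfrac{\sigma_k}2\|\nabla u-p\|^2,\qquad p=S_{\alpha/\sigma_k}(\lambda^k/\sigma_k+\nabla u).$$ **Algorithms.** Let $0<\sigma_0\le\sigma_1\le\cdots$, $\sigma_k\to\sigma_\infty<\infty$; $u^0$ and $\lambda^0$ are arbitrary. In outer iteration $k$, $u^{k+1}$ is the result of finitely many inner semismooth Newton steps, started at $u^k$, for minimising $\Phi_k$; the linear systems may be solved inexactly, up to residuals bounded by arbitrary given tolerances. Then $p^{k+1}=S_{\alpha/\sigma_k}(\lambda^k/\sigma_k+\nabla u^{k+1})$. * In ALM-PDP and ALM-PDD the inner steps are primal-dual Newton steps for the system $Hu-f+\nabla^*h=0$, $\ \max(1,|\lambda^k+\sigma_k\nabla u|/\alpha)\,h=\lambda^k+\sigma_k\nabla u$, with Newton derivative $\begin{pmatrix}H&\nabla^*\\ C&U\end{pmatrix}$ at $(u,h)$, where, with $q=\lambda^k+\sigma_k\nabla u$, $U=\max(1,|q|/\alpha)$ and $Cv=-\sigma_k\nabla v+\mathbf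 1_{\{|q|\ge\alpha\}}\tfrac{\sigma_k}{\alpha}\tfrac{\langle q,\nabla v\rangle}{|q|}h$ pixelwise. The auxiliary variable $h$ starts feasible ($|h_x|\le\alpha$) and is projected by $\mathcal P_\alpha$ after each step. ALM-PDP eliminates $h$ and solves for $u$ first; ALM-PDD eliminates $u$ and solves for $h$ first. The multiplier update is $\lambda^{k+1}=\mathcal P_\alpha(\lambda^k+\sigma_k\nabla u^{k+1})$. * In ALM-PT the inner steps are Newton steps for $F(u)=\nabla\Phi_k(u)=Hu-f+\nabla^*\lambda^k+\sigma_k\nabla^*\nabla u-\sigma_k\nabla^*S_{\alpha/\sigma_k}(\lambda^k/\sigma_k+\nabla u)=0$, with Newton derivative $H+\sigma_k\nabla^*\nabla-\sigma_k\nabla^*A\nabla$, where, with $y=\lambda^k/\sigma_k+\nabla u$, $Aw=w-\tfrac{\alpha}{\sigma_k}\bigl(\tfrac{w}{|y|}-\tfrac{\langle y,w\rangle y}{|y|^3}\bigr)$ at pixels with $|y|\ge\alpha/\sigma_k$ and $Aw=0$ elsewhere. The steps use backtracking Armijo line search with step lengths $\vartheta^j$, $j=0,1,\dots$, $\vartheta\in(0,1)$,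 and Armijo constant in $(0,\tfrac12)$. The multiplier update is $\lambda^{k+1}=\lambda^k+\sigma_k(\nabla u^{k+1}-p^{k+1})$. The stopping criteria are $$\text{(A)}\quad \Phi_k(u^{k+1})-\inf\Phi_k\le\frac{\epsilon_k^2}{2\sigma_k},\quad \epsilon_k\ge0,\ \sum_k\epsilon_k<\infty;$$ $$\text{(B1)}\quad \Phi_k(u^{k+1})-\inf\Phi_k\le\frac{\delta_k^2}{2\sigma_k}\|\lambda^{k+1}-\lambda^k\|^2,\quad \delta_k\ge0,\ \sum_k\delta_k<\infty.$$ **Nondegeneracy assumption on $\partial d$.** There is $\bar\lambda\in\mathcal X^I$ such that, with $\bar g=\mathrm{Div}^*H^{-1}(\mathrm{Div}\bar\lambda+f)$, at every pixel $x$ either $|\bar\lambda_x|=\alpha$, $\bar g_x\ne0$ and $-\bar g_x$ lies in the normal cone at $\bar\lambda_x$ of the closed disc of radius $\alpha$, or $|\bar\lambda_x|<\alpha$. A set-valued map $T$ is called metrically subregular at $\bar x$ for $\bar y$ with modulus $\kappa\ge0$ if $\bar y\in T(\bar x)$ and there are neighbourhoods $U$ of $\bar x$ and $V$ of $\bar y$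 with $\mathrm{dist}(x,T^{-1}(\bar y))\le\kappa\,\mathrm{dist}(\bar y,T(x)\cap V)$ for all $x\in U$. **Theorem.** Let $(u^k,p^k,\lambda^k)$ be generated by ALM-PDP, ALM-PDD or ALM-PT with criterion (A). Then the sequence is bounded and converges to some $(u^*,p^*,\lambda^*)$, where $u^*$ solves the primal problem, $p^*=\nabla u^*$ and $\lambda^*\in\mathcal X^I$. Suppose in addition that the nondegeneracy assumption holds. Then there is one $\kappa$ such that $\partial d$ is metrically subregular for the origin with modulus $\kappa$ at every point of $\mathcal X^I$. If moreover (B1) is satisfied, then for every modulus $\kappa_d$ of metric subregularity of $\partial d$ at $\lambda^*$ for the origin, and for all sufficiently large $k$, $$\mathrm{dist}(\lambda^{k+1},\mathcal X^I)\le\theta_k\,\mathrm{dist}(\lambda^k,\mathcal X^I),\qquad \theta_k=\bigl[\kappa_d(\kappa_d^2+\sigma_k^2)^{-1/2}+\delta_k\bigr](1-\delta_k)^{-1},$$ and $\theta_k\to\theta_\infty=\kappa_d(\kappa_d^2+\sigma_\infty^2)^{-1/2}<1$. -/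

import Mathlib

open Filter Topology

noncomputable section

/-- Image space `X`: real functions on the `M × N` pixel grid with the `ℓ²` scalar product. -/
abbrev ImgX (M N : ℕ) : Type := EuclideanSpace ℝ (Fin M × Fin N)

/-- Vector field space `Y = X²`, stored pixelwise: `q x ∈ ℝ²` is the value at pixel `x`, and
`‖q‖² = ∑ₓ |q x|²`. -/
abbrev ImgY (M N : ℕ) : Type := PiLp 2 (fun _ : Fin M × Fin N => EuclideanSpace ℝ (Fin 2))

/-- Discrete gradient: forward differences, set to `0` across the last row / column. -/
def grad (M N : ℕ) : ImgX M N →ₗ[ℝ] ImgY M N where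
  toFun u := WithLp.toLp 2 fun x => !₂[
    if h : x.1.val + 1 < M then u (⟨x.1.val + 1, h⟩, x.2) - u x else 0,
    if h : x.2.val + 1 < N then u (x.1, ⟨x.2.val + 1, h⟩) - u x else 0]
  map_add' u v := by
    ext x i
    fin_cases i
    · by_cases h : x.1.val + 1 < M
      · simp [h]; ring
      · simp [h]
    · by_cases h : x.2.val + 1 < N
      · simp [h]; ring
      · simp [h]
  map_smul' c u := by
    ext x i
    fin_cases i
    · by_cases h : x.1.val + 1 < M
      · simp [h]; ring
      · simp [h]
    · by_cases h : x.2.val + 1 < N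
      · simp [h]; ring
      · simp [h]

/-- The adjoint `∇*` of the discrete gradient. -/
def gradAdj (M N : ℕ) : ImgY M N →ₗ[ℝ] ImgX M N := LinearMap.adjoint (grad M N)

/-- The discrete divergence `Div = -∇*`. -/
def discDiv (M N : ℕ) : ImgY M N →ₗ[ℝ] ImgX M N := -gradAdj M N

/-! Convex analysis for extended real valued functions and set valued maps. -/

open Classical in
/-- The indicator function of `C`: `0` on `C`, `+∞` off `C`. -/
def indicatorE {E : Type*} (C : Set E) (x : E) : EReal := if x ∈ C then 0 else ⊤

/-- The convex subdifferential of `F : E → (-∞, +∞]` at `x`; it is empty off the domain of `F`. -/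
def subdiff {E : Type*} [NormedAddCommGroup E] [InnerProductSpace ℝ E]
    (F : E → EReal) (x : E) : Set E :=
  {g | F x ≠ ⊤ ∧ ∀ y, F x + ((inner ℝ g (y - x) : ℝ) : EReal) ≤ F y}

/-- `T : E ⇉ F` is metrically subregular at `x₀` for `y₀` with modulus `κ`: `y₀ ∈ T x₀` and
`dist (x, T⁻¹ y₀) ≤ κ dist (y₀, T x ∩ V)` for all `x ∈ U`, with neighbourhoods `U` of `x₀`, `V` of
`y₀`. The bound is written for every element of `T x ∩ V`, so it is void where that set is empty
(distance `+∞`). -/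
def MetricSubregularAt {E F : Type*} [PseudoMetricSpace E] [PseudoMetricSpace F]
    (T : E → Set F) (x₀ : E) (y₀ : F) (κ : ℝ) : Prop :=
  0 ≤ κ ∧ y₀ ∈ T x₀ ∧ ∃ U ∈ 𝓝 x₀, ∃ V ∈ 𝓝 y₀,
    ∀ x ∈ U, ∀ y ∈ T x ∩ V, Metric.infDist x {x' | y₀ ∈ T x'} ≤ κ * dist y₀ y

/-! Pixelwise operations of the isotropic model. -/

section Pixel

variable {M N : ℕ}

/-- The isotropic norm `‖p‖₁ = ∑ₓ |p x|`. -/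
def isoNorm1 (p : ImgY M N) : ℝ := ∑ x, ‖p x‖

/-- The set `{‖q‖_∞ ≤ a}`, with the isotropic maximum norm. -/
def isoBall (M N : ℕ) (a : ℝ) : Set (ImgY M N) := {q | ∀ x, ‖q x‖ ≤ a}

/-- The isotropic projection `q / max (1, |q| / a)` onto `{‖q‖_∞ ≤ a}`. -/
def isoProj (a : ℝ) (q : ImgY M N) : ImgY M N :=
  WithLp.toLp 2 fun x => (max 1 (‖q x‖ / a))⁻¹ • q x

/-- The isotropic soft thresholding operator `S_τ`, the resolvent of `τ ∂‖·‖₁`. -/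
def softThr (τ : ℝ) (q : ImgY M N) : ImgY M N :=
  WithLp.toLp 2 fun x => (max 0 (1 - τ / ‖q x‖)) • q x

/-- Pixelwise product of a scalar field and a vector field. -/
def pixMul (w : Fin M × Fin N → ℝ) (q : ImgY M N) : ImgY M N :=
  WithLp.toLp 2 fun x => w x • q x

end Pixel

/-- Data of the TV model `min_u ‖K u - z‖² / 2 + (μ / 2) ‖∇ u‖² + α ‖∇ u‖₁`. -/
structure TVData (M N : ℕ) (Z : Type*) [NormedAddCommGroup Z] [InnerProductSpace ℝ Z] where
  K : ImgX M N →ₗ[ℝ] Z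
  z : Z
  μ : ℝ
  α : ℝ

namespace TVData

variable {M N : ℕ} {Z : Type*} [NormedAddCommGroup Z] [InnerProductSpace ℝ Z]
  [FiniteDimensional ℝ Z]

/-- The smooth part `D u`. -/
def D (P : TVData M N Z) (u : ImgX M N) : ℝ :=
  ‖P.K u - P.z‖ ^ 2 / 2 + P.μ / 2 * ‖grad M N u‖ ^ 2

/-- The primal objective `D u + α ‖∇ u‖₁`. -/
def primal (P : TVData M N Z) (u : ImgX M N) : ℝ := P.D u + P.α * isoNorm1 (grad M N u)

/-- `f = K* z`. -/
def f (P : TVData M N Z) : ImgX M N := LinearMap.adjoint P.K P.z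

/-- `H = -μ Δ + K* K`, where `-Δ = ∇* ∇`. -/
def H (P : TVData M N Z) : Module.End ℝ (ImgX M N) :=
  P.μ • (gradAdj M N ∘ₗ grad M N) + LinearMap.adjoint P.K ∘ₗ P.K

/-- `H⁻¹`; it is the inverse when `H` is positive definite. -/
def Hinv (P : TVData M N Z) : Module.End ℝ (ImgX M N) := Ring.inverse P.H

/-- The smooth part `‖Div λ + f‖²_{H⁻¹} / 2 - ‖z‖² / 2` of the dual objective. -/
def dualSmooth (P : TVData M N Z) (lam : ImgY M N) : ℝ :=
  inner ℝ (P.Hinv (discDiv M N lam + P.f)) (discDiv M N lam + P.f) / 2 - ‖P.z‖ ^ 2 / 2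

/-- The dual function `d`; the dual problem is to maximise `-d`. -/
def d (P : TVData M N Z) (lam : ImgY M N) : EReal :=
  (P.dualSmooth lam : EReal) + indicatorE (isoBall M N P.α) lam

/-- The solution set `𝒳ᴵ` of the dual problem. -/
def dualSol (P : TVData M N Z) : Set (ImgY M N) := {lam | ∀ lam', P.d lam ≤ P.d lam'}

/-- The gradient `Div* H⁻¹ (Div λ + f)` of the smooth part of `d`. At a dual solution it is `-∇ u`
with `u` the primal solution. -/
def dualGrad (P : TVData M N Z) (lam : ImgY M N) : ImgY M N :=
  LinearMap.adjoint (discDiv M N) (P.Hinv (discDiv M N lam + P.f))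

/-- The nondegeneracy assumption on `∂d`: some dual solution `λ` has at each pixel either
`|λ x| = α` together with `-g x ∈ N(λ x)`, `g x ≠ 0` for `g` the gradient of the smooth part of `d`
at `λ`, or `|λ x| < α`. Here `N` is the normal cone of the closed disc of radius `α`. -/
def Nondegenerate (P : TVData M N Z) : Prop :=
  ∃ lam ∈ P.dualSol, ∀ x,
    (lam x ∈ frontier (Metric.closedBall (0 : EuclideanSpace ℝ (Fin 2)) P.α) ∧
      P.dualGrad lam x ≠ 0 ∧
      -(P.dualGrad lam x) ∈
        subdiff (indicatorE (Metric.closedBall (0 : EuclideanSpace ℝ (Fin 2)) P.α)) (lam x)) ∨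
    lam x ∈ interior (Metric.closedBall (0 : EuclideanSpace ℝ (Fin 2)) P.α)

/-- The augmented Lagrangian `L(u, p; λ)` with step size `s`. -/
def augL (P : TVData M N Z) (s : ℝ) (lam : ImgY M N) (u : ImgX M N) (p : ImgY M N) : ℝ :=
  P.D u + P.α * isoNorm1 p + inner ℝ lam (grad M N u - p) + s / 2 * ‖grad M N u - p‖ ^ 2

/-- The minimiser `S_{α/s}(λ / s + ∇ u)` of `L(u, ·; λ)`. -/
def pOf (P : TVData M N Z) (s : ℝ) (lam : ImgY M N) (u : ImgX M N) : ImgY M N :=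
  softThr (P.α / s) (s⁻¹ • lam + grad M N u)

/-- The reduced augmented Lagrangian `Φ(u; λ, s) = L(u, S_{α/s}(λ / s + ∇ u); λ)`. -/
def Phi (P : TVData M N Z) (s : ℝ) (lam : ImgY M N) (u : ImgX M N) : ℝ :=
  P.augL s lam u (P.pOf s lam u)

/-! The inner semismooth Newton solvers. Linear systems are solved iteratively, so each of them is
required up to a residual of norm at most `tol`. -/

/-- `λ + s ∇ u`. -/
def qOf (s : ℝ) (lam : ImgY M N) (u : ImgX M N) : ImgY M N := lam + s • grad M N u

/-- The field `max (1, |λ + s ∇ u| / α)`. -/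
def Uof (P : TVData M N Z) (s : ℝ) (lam : ImgY M N) (u : ImgX M N) (x : Fin M × Fin N) : ℝ :=
  max 1 (‖qOf s lam u x‖ / P.α)

open Classical in
/-- `B v = χ (s / α) (⟨λ + s ∇ u, ∇ v⟩ / |λ + s ∇ u|) h`, where `χ` is the characteristic function
of `|λ + s ∇ u| ≥ α`. -/
def Bop (P : TVData M N Z) (s : ℝ) (lam : ImgY M N) (u : ImgX M N) (h : ImgY M N)
    (v : ImgX M N) : ImgY M N :=
  pixMul (fun x => if P.α ≤ ‖qOf s lam u x‖ then
    s / P.α * (inner ℝ (qOf s lam u x) (grad M N v x) / ‖qOf s lam u x‖) else 0) h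

/-- `C v = -s ∇ v + B v`. -/
def Cop (P : TVData M N Z) (s : ℝ) (lam : ImgY M N) (u : ImgX M N) (h : ImgY M N)
    (v : ImgX M N) : ImgY M N :=
  -(s • grad M N v) + P.Bop s lam u h v

/-- One primal-dual Newton step `(u, h) ↦ (u', h')`, primal variable first:
`(H - ∇* U⁻¹ C) u' = f + Div (U⁻¹ b)` with `b = λ + B u`, then `h' = P_α (U⁻¹ (b - C u'))`. -/
def StepPDP (P : TVData M N Z) (s : ℝ) (lam : ImgY M N) (tol : ℝ)
    (u : ImgX M N) (h : ImgY M N) (u' : ImgX M N) (h' : ImgY M N) : Prop :=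
  ‖(P.H u' - gradAdj M N (pixMul (fun x => (P.Uof s lam u x)⁻¹) (P.Cop s lam u h u'))) -
    (P.f + discDiv M N (pixMul (fun x => (P.Uof s lam u x)⁻¹) (lam + P.Bop s lam u h u)))‖ ≤ tol ∧
  h' = isoProj P.α (pixMul (fun x => (P.Uof s lam u x)⁻¹)
    ((lam + P.Bop s lam u h u) - P.Cop s lam u h u'))

/-- One primal-dual Newton step `(u, h) ↦ (u', h')`, dual variable first:
`(U - C H⁻¹ ∇*) g = b - C H⁻¹ f`, then `u' = H⁻¹ (f + Div g)` and `h' = P_α g`. -/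
def StepPDD (P : TVData M N Z) (s : ℝ) (lam : ImgY M N) (tol : ℝ)
    (u : ImgX M N) (h : ImgY M N) (u' : ImgX M N) (h' : ImgY M N) : Prop :=
  ∃ g : ImgY M N,
    ‖(pixMul (P.Uof s lam u) g - P.Cop s lam u h (P.Hinv (gradAdj M N g))) -
      ((lam + P.Bop s lam u h u) - P.Cop s lam u h (P.Hinv P.f))‖ ≤ tol ∧
    u' = P.Hinv (P.f + discDiv M N g) ∧ h' = isoProj P.α g

/-- The gradient of `Φ(·; λ, s)`:
`H u - f + ∇* λ + s ∇* ∇ u - s ∇* S_{α/s}(λ / s + ∇ u)`. -/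
def FI (P : TVData M N Z) (s : ℝ) (lam : ImgY M N) (u : ImgX M N) : ImgX M N :=
  P.H u - P.f + gradAdj M N lam + s • gradAdj M N (grad M N u)
    - s • gradAdj M N (P.pOf s lam u)

open Classical in
/-- The generalised derivative of soft thresholding: with `y = λ / s + ∇ u`,
`w ↦ w - (α / s) (w / |y| - ⟨y, w⟩ y / |y|³)` where `|y| ≥ α / s`, and `0` elsewhere. -/
def AI (P : TVData M N Z) (s : ℝ) (lam : ImgY M N) (u : ImgX M N) (w : ImgY M N) : ImgY M N :=
  WithLp.toLp 2 fun x =>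
    let y : EuclideanSpace ℝ (Fin 2) := s⁻¹ • lam x + grad M N u x
    if P.α / s ≤ ‖y‖ then
      w x - (P.α / s) • ((‖y‖)⁻¹ • w x - (inner ℝ y (w x) / ‖y‖ ^ 3) • y)
    else 0

/-- One Newton step `u ↦ u'` for `F(u) = 0`, with backtracking Armijo line search of parameters
`m` and `ϑ`. -/
def StepPT (P : TVData M N Z) (s : ℝ) (lam : ImgY M N) (m ϑ tol : ℝ)
    (u u' : ImgX M N) : Prop :=
  ∃ δu : ImgX M N,
    ‖(P.H δu + s • gradAdj M N (grad M N δu)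
      - s • gradAdj M N (P.AI s lam u (grad M N δu))) - (-(P.FI s lam u))‖ ≤ tol ∧
    ∃ j : ℕ,
      P.Phi s lam (u + ϑ ^ j • δu) ≤
        P.Phi s lam u + m * ϑ ^ j * inner ℝ (P.FI s lam u) δu ∧
      (∀ i < j, P.Phi s lam u + m * ϑ ^ i * inner ℝ (P.FI s lam u) δu <
        P.Phi s lam (u + ϑ ^ i • δu)) ∧
      u' = u + ϑ ^ j • δu

/-- `u'` is the output of finitely many primal-dual Newton steps of the given kind started at
`u₀` and a feasible auxiliary variable. -/
def RunPD (P : TVData M N Z)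
    (step : ℝ → ImgX M N → ImgY M N → ImgX M N → ImgY M N → Prop)
    (tol : ℕ → ℝ) (u₀ u' : ImgX M N) : Prop :=
  ∃ (n : ℕ) (v : ℕ → ImgX M N) (h : ℕ → ImgY M N),
    v 0 = u₀ ∧ h 0 ∈ isoBall M N P.α ∧
    (∀ l < n, step (tol l) (v l) (h l) (v (l + 1)) (h (l + 1))) ∧ u' = v n

/-- `u'` is the output of finitely many Newton steps with line search started at `u₀`. -/
def RunPT (P : TVData M N Z) (s : ℝ) (lam : ImgY M N) (m ϑ : ℝ)
    (tol : ℕ → ℝ) (u₀ u' : ImgX M N) : Prop :=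
  ∃ (n : ℕ) (v : ℕ → ImgX M N),
    v 0 = u₀ ∧ (∀ l < n, P.StepPT s lam m ϑ (tol l) (v l) (v (l + 1))) ∧ u' = v n

/-! The augmented Lagrangian methods. `tol k l` is the tolerance of the linear solver in inner
iteration `l` of outer iteration `k`. -/

/-- `(u, p, λ)` is generated by ALM-PDP with step sizes `σ`. -/
def IsALMPDP (P : TVData M N Z) (σ : ℕ → ℝ) (tol : ℕ → ℕ → ℝ)
    (u : ℕ → ImgX M N) (p lam : ℕ → ImgY M N) : Prop :=
  ∀ k, P.RunPD (P.StepPDP (σ k) (lam k)) (tol k) (u k) (u (k + 1)) ∧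
    p (k + 1) = P.pOf (σ k) (lam k) (u (k + 1)) ∧
    lam (k + 1) = isoProj P.α (lam k + σ k • grad M N (u (k + 1)))

/-- `(u, p, λ)` is generated by ALM-PDD with step sizes `σ`. -/
def IsALMPDD (P : TVData M N Z) (σ : ℕ → ℝ) (tol : ℕ → ℕ → ℝ)
    (u : ℕ → ImgX M N) (p lam : ℕ → ImgY M N) : Prop :=
  ∀ k, P.RunPD (P.StepPDD (σ k) (lam k)) (tol k) (u k) (u (k + 1)) ∧
    p (k + 1) = P.pOf (σ k) (lam k) (u (k + 1)) ∧
    lam (k + 1) = isoProj P.α (lam k + σ k • grad M N (u (k + 1)))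

/-- `(u, p, λ)` is generated by ALM-PT with step sizes `σ`. -/
def IsALMPT (P : TVData M N Z) (σ : ℕ → ℝ) (tol : ℕ → ℕ → ℝ)
    (u : ℕ → ImgX M N) (p lam : ℕ → ImgY M N) : Prop :=
  ∃ m ∈ Set.Ioo (0 : ℝ) (1 / 2), ∃ ϑ ∈ Set.Ioo (0 : ℝ) 1,
    ∀ k, P.RunPT (σ k) (lam k) m ϑ (tol k) (u k) (u (k + 1)) ∧
      p (k + 1) = P.pOf (σ k) (lam k) (u (k + 1)) ∧
      lam (k + 1) = lam k + σ k • (grad M N (u (k + 1)) - p (k + 1))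

/-- Stopping criterion (A). -/
def CritA (P : TVData M N Z) (σ ε : ℕ → ℝ) (u : ℕ → ImgX M N) (lam : ℕ → ImgY M N) : Prop :=
  (∀ k, 0 ≤ ε k) ∧ Summable ε ∧
  ∀ k, P.Phi (σ k) (lam k) (u (k + 1)) - ⨅ v, P.Phi (σ k) (lam k) v ≤ ε k ^ 2 / (2 * σ k)

/-- Stopping criterion (B1). -/
def CritB1 (P : TVData M N Z) (σ δ : ℕ → ℝ) (u : ℕ → ImgX M N) (lam : ℕ → ImgY M N) : Prop :=
  (∀ k, 0 ≤ δ k) ∧ Summable δ ∧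
  ∀ k, P.Phi (σ k) (lam k) (u (k + 1)) - ⨅ v, P.Phi (σ k) (lam k) v ≤
    δ k ^ 2 / (2 * σ k) * ‖lam (k + 1) - lam k‖ ^ 2

end TVData

/-- `θ = [κ (κ² + s²)^(-1/2) + δ] (1 - δ)⁻¹`. -/
def almRate (κ s δ : ℝ) : ℝ := (κ / √(κ ^ 2 + s ^ 2) + δ) * (1 - δ)⁻¹

end

/-! The augmented Lagrangian method is an inexact proximal point method for the dual function `d`.
The way the inner Newton steps produce `u (k + 1)` is irrelevant: only the size of its gap in `Φ`
and the multiplier update enter. By the Moreau decomposition, all three updates are the same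
projection.

Let `m k` be the proximal point of `d` at `lam k`. The reduced Lagrangian is strongly convex-concave
around the saddle point formed by `m k` and `w = H⁻¹ (Div m + f)`. Hence the gap dominates both the
`H`-energy of `u - w` and `‖lam (k + 1) - m k‖² / (2 σ)` (`IsProx.gap_le`). Criterion (A) thus makes
the multiplier errors summable. Firm quasi-nonexpansiveness and quasi-Fejér monotonicity give
convergence of the multipliers, and the energy term carries it to `u` and then to `p`.

For subregularity, `d` grows quadratically in two quantities: in `Div λ`, since `H⁻¹` is positive
definite, and in `√|g x| λ x`, since a linear functional on a disc grows quadratically away from its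
minimiser. Together they form `residual`, which is constant on the solution set. Nondegeneracy
leaves slack in the disc constraint wherever `g x = 0`, so an exact solution of the linear residual
equation can be pulled back into the ball at proportional cost. This makes the residual an error
bound for the solution set. With monotonicity it yields the global estimate `dist ≤ κ ‖y‖` for `y ∈
∂d`. Combining this estimate with the Pythagorean inequality for the proximal step gives the
contraction factor, and (B1) perturbs it by `δ k`. -/

theorem continuous_linearMap {E F : Type*} [NormedAddCommGroup E] [InnerProductSpace ℝ E]
    [FiniteDimensional ℝ E] [NormedAddCommGroup F] [InnerProductSpace ℝ F] (T : E →ₗ[ℝ] F) :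
    Continuous T :=
  LinearMap.continuous_of_finiteDimensional T

theorem exists_pos_mul_norm_sq_le_inner {E : Type*} [NormedAddCommGroup E] [InnerProductSpace ℝ E]
    [FiniteDimensional ℝ E] (T : E →ₗ[ℝ] E) (hT : ∀ u, u ≠ 0 → 0 < inner ℝ (T u) u) :
    ∃ c > 0, ∀ u, c * ‖u‖ ^ 2 ≤ inner ℝ (T u) u := by
  have hcont : Continuous fun u : E => (inner ℝ (T u) u : ℝ) :=
    (LinearMap.continuous_of_finiteDimensional T).inner continuous_id
  -- This form of the extreme value theorem also covers an empty sphere, which occurs for an empty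
  -- pixel grid.
  obtain ⟨c, hc, hmin⟩ := (isCompact_sphere (0 : E) 1).exists_forall_le' hcont.continuousOn
    (a := 0) fun u hu => hT u (by rintro rfl; simp at hu)
  refine ⟨c, hc, fun u => ?_⟩
  by_cases hu : u = 0
  · simp [hu]
  have hn : 0 < ‖u‖ := norm_pos_iff.2 hu
  have h := hmin (‖u‖⁻¹ • u) (by simp [norm_smul, hn.ne'])
  simp only [map_smul, inner_smul_left, inner_smul_right, RCLike.conj_to_real] at h
  have h2 := mul_le_mul_of_nonneg_left h (sq_nonneg ‖u‖)
  have h3 : ‖u‖ ^ 2 * (‖u‖⁻¹ * (‖u‖⁻¹ * inner ℝ (T u) u)) = inner ℝ (T u) u := by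
    field_simp
  linarith

/-- Divide by `t` and let `t → 0`. This turns minimality along segments of the ball into first-order
variational inequalities. -/
theorem nonneg_of_forall_quadratic_nonneg {a b : ℝ}
    (h : ∀ t : ℝ, 0 < t → t ≤ 1 → 0 ≤ t * a + t ^ 2 * b) : 0 ≤ a := by
  have h1 : Tendsto (fun t : ℝ => a + t * b) (𝓝[>] 0) (𝓝 (a + 0 * b)) :=
    ((continuous_const.add (continuous_id.mul continuous_const)).tendsto 0).mono_left
      nhdsWithin_le_nhds
  rw [zero_mul, add_zero] at h1
  refine ge_of_tendsto h1 ?_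
  filter_upwards [Ioc_mem_nhdsGT (zero_lt_one' ℝ)] with t ht
  have h2 := h t ht.1 ht.2
  have h3 : t * a + t ^ 2 * b = t * (a + t * b) := by ring
  rw [h3] at h2
  exact nonneg_of_mul_nonneg_right h2 ht.1

/-! ### Pixelwise projection and soft thresholding. -/

section Pixel

variable {M N : ℕ}

theorem inner_gradAdj_left (q : ImgY M N) (u : ImgX M N) :
    inner ℝ (gradAdj M N q) u = inner ℝ q (grad M N u) :=
  LinearMap.adjoint_inner_left _ _ _

theorem inner_discDiv_left (q : ImgY M N) (u : ImgX M N) :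
    inner ℝ (discDiv M N q) u = -inner ℝ q (grad M N u) := by
  simp [discDiv, inner_gradAdj_left, inner_neg_left]

theorem adjoint_discDiv_apply (u : ImgX M N) :
    LinearMap.adjoint (discDiv M N) u = -grad M N u := by
  refine ext_inner_left ℝ fun q => ?_
  rw [LinearMap.adjoint_inner_right, inner_discDiv_left, inner_neg_right]

theorem convex_isoBall (a : ℝ) : Convex ℝ (isoBall M N a) := by
  intro p hp q hq s t hs ht hst x
  have h : (s • p + t • q) x ∈ Metric.closedBall (0 : EuclideanSpace ℝ (Fin 2)) a :=
    convex_closedBall (0 : EuclideanSpace ℝ (Fin 2)) a (by simpa using hp x) (by simpa using hq x)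
      hs ht hst
  simpa using h

theorem isCompact_isoBall (a : ℝ) : IsCompact (isoBall M N a) := by
  refine Metric.isCompact_of_isClosed_isBounded ?_ ?_
  · simp only [isoBall, Set.ofPred_forall]
    exact isClosed_iInter fun x => isClosed_le (by fun_prop) continuous_const
  · refine (Metric.isBounded_closedBall (x := (0 : ImgY M N))
      (r := √(∑ _x : Fin M × Fin N, a ^ 2))).subset fun q hq => ?_
    rw [mem_closedBall_zero_iff]
    refine Real.le_sqrt_of_sq_le ?_
    rw [PiLp.norm_sq_eq_of_L2]
    exact Finset.sum_le_sum fun x _ => pow_le_pow_left₀ (norm_nonneg _) (hq x) 2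

theorem zero_mem_isoBall {a : ℝ} (ha : 0 ≤ a) : (0 : ImgY M N) ∈ isoBall M N a := fun x => by
  simpa using ha

theorem isoProj_mem_isoBall {a : ℝ} (ha : 0 < a) (q : ImgY M N) :
    isoProj a q ∈ isoBall M N a := fun x => by
  have hm : 0 < max 1 (‖q x‖ / a) := lt_max_of_lt_left one_pos
  simp only [isoProj, norm_smul, norm_inv, Real.norm_of_nonneg hm.le]
  rw [inv_mul_le_iff₀ hm, ← div_le_iff₀ ha]
  exact le_max_right _ _

/-- Moreau decomposition of `q` into the projection and the soft thresholding. -/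
theorem isoProj_add_smul_softThr {a s : ℝ} (ha : 0 < a) (hs : 0 < s) (q : ImgY M N) :
    isoProj a q + s • softThr (a / s) (s⁻¹ • q) = q := by
  refine PiLp.ext fun x => ?_
  simp only [isoProj, softThr, PiLp.add_apply, PiLp.smul_apply, norm_smul, norm_inv,
    Real.norm_of_nonneg hs.le]
  rw [smul_smul, smul_smul, ← add_smul]
  have h1 : a / s / (s⁻¹ * ‖q x‖) = a / ‖q x‖ := by
    field_simp
  rw [h1]
  rcases eq_or_ne (q x) 0 with h0 | h0
  · simp [h0]
  have hn : 0 < ‖q x‖ := norm_pos_iff.2 h0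
  convert one_smul ℝ (q x)
  -- Inside the disc the thresholded part vanishes; outside, the coefficients `a / |q|` and `1 - a /
  -- |q|` add up to one.
  rcases le_total ‖q x‖ a with h | h
  · rw [max_eq_left ((div_le_one ha).2 h), max_eq_left (by rw [sub_nonpos, one_le_div hn]; exact h)]
    simp
  · rw [max_eq_right ((one_le_div ha).2 h),
      max_eq_right (by rw [sub_nonneg, div_le_one hn]; exact h)]
    field_simp
    ring

/-- Complementarity: where the thresholded field is nonzero, the projection lies on the circle of
radius `a` in the same direction, so Cauchy-Schwarz is an equality. -/
theorem inner_isoProj_softThr {a s : ℝ} (ha : 0 < a) (hs : 0 < s) (q : ImgY M N) :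
    inner ℝ (isoProj a q) (softThr (a / s) (s⁻¹ • q)) =
      a * isoNorm1 (softThr (a / s) (s⁻¹ • q)) := by
  rw [PiLp.inner_apply, isoNorm1, Finset.mul_sum]
  refine Finset.sum_congr rfl fun x _ => ?_
  simp only [isoProj, softThr, PiLp.smul_apply, norm_smul, norm_inv,
    Real.norm_of_nonneg hs.le]
  have h1 : a / s / (s⁻¹ * ‖q x‖) = a / ‖q x‖ := by
    field_simp
  rw [h1, Real.norm_of_nonneg (le_max_left _ _)]
  simp only [inner_smul_left, inner_smul_right, RCLike.conj_to_real, real_inner_self_eq_norm_sq]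
  rcases eq_or_ne (q x) 0 with h0 | h0
  · simp [h0]
  have hn : 0 < ‖q x‖ := norm_pos_iff.2 h0
  rcases le_total ‖q x‖ a with h | h
  · rw [max_eq_left (b := 1 - a / ‖q x‖) (by rw [sub_nonpos, one_le_div hn]; exact h)]
    simp
  · rw [max_eq_right ((one_le_div ha).2 h)]
    field_simp

theorem inner_le_mul_isoNorm1 {a : ℝ} {m : ImgY M N} (hm : m ∈ isoBall M N a) (p : ImgY M N) :
    inner ℝ m p ≤ a * isoNorm1 p := by
  rw [PiLp.inner_apply, isoNorm1, Finset.mul_sum]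
  exact Finset.sum_le_sum fun x _ => (real_inner_le_norm _ _).trans
    (mul_le_mul_of_nonneg_right (hm x) (norm_nonneg _))

/-- The remainder of the projection is a soft thresholding (with `s = 1`). Its pairing with the
projection attains the bound that its pairing with any `m` in the ball obeys. -/
theorem inner_sub_isoProj_nonpos {a : ℝ} (ha : 0 < a) (q : ImgY M N) {m : ImgY M N}
    (hm : m ∈ isoBall M N a) : inner ℝ (q - isoProj a q) (m - isoProj a q) ≤ 0 := by
  have h1 := isoProj_add_smul_softThr ha one_pos q
  have h2 := inner_isoProj_softThr ha one_pos q
  have h3 := inner_le_mul_isoNorm1 hm (softThr (a / 1) ((1 : ℝ)⁻¹ • q))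
  rw [one_smul] at h1
  have h4 : q - isoProj a q = softThr (a / 1) ((1 : ℝ)⁻¹ • q) := by
    rw [sub_eq_iff_eq_add']; exact h1.symm
  rw [h4, inner_sub_right, real_inner_comm, real_inner_comm (isoProj a q)]
  linarith

/-- The variational inequality characterises the projection. -/
theorem isoProj_eq_of_inner_nonpos {a : ℝ} (ha : 0 < a) {q m : ImgY M N}
    (hm : m ∈ isoBall M N a) (h : ∀ v ∈ isoBall M N a, inner ℝ (q - m) (v - m) ≤ 0) :
    isoProj a q = m := by
  have h1 := inner_sub_isoProj_nonpos ha q hm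
  have h2 := h _ (isoProj_mem_isoBall ha q)
  have h3 : inner ℝ (isoProj a q - m) (isoProj a q - m) ≤ 0 := by
    have : inner ℝ (isoProj a q - m) (isoProj a q - m) =
        inner ℝ (q - isoProj a q) (m - isoProj a q) + inner ℝ (q - m) (isoProj a q - m) := by
      simp only [inner_sub_left, inner_sub_right, real_inner_comm]; ring
    linarith
  rw [real_inner_self_eq_norm_sq] at h3
  exact sub_eq_zero.1 (norm_eq_zero.1 (pow_eq_zero_iff two_ne_zero |>.1
    (le_antisymm h3 (sq_nonneg _))))

end Pixel

namespace TVData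

variable {M N : ℕ} {Z : Type*} [NormedAddCommGroup Z] [InnerProductSpace ℝ Z]
  [FiniteDimensional ℝ Z]

/-! The quadratic parts of the primal and the dual objective. -/

theorem inner_H_left (P : TVData M N Z) (u v : ImgX M N) :
    inner ℝ (P.H u) v = P.μ * inner ℝ (grad M N u) (grad M N v) + inner ℝ (P.K u) (P.K v) := by
  simp [H, inner_add_left, inner_smul_left, inner_gradAdj_left, LinearMap.adjoint_inner_left]

theorem inner_H_comm (P : TVData M N Z) (u v : ImgX M N) :
    inner ℝ (P.H u) v = inner ℝ u (P.H v) := by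
  rw [real_inner_comm (P.H v), inner_H_left, inner_H_left, real_inner_comm (grad M N v),
    real_inner_comm (P.K v)]

theorem inner_H_nonneg (P : TVData M N Z)
    (hH : ∀ u : ImgX M N, u ≠ 0 → 0 < inner ℝ (P.H u) u) (u : ImgX M N) :
    0 ≤ inner ℝ (P.H u) u := by
  rcases eq_or_ne u 0 with rfl | hu
  · simp
  · exact (hH u hu).le

theorem isUnit_H (P : TVData M N Z) (hH : ∀ u : ImgX M N, u ≠ 0 → 0 < inner ℝ (P.H u) u) :
    IsUnit P.H := by
  rw [LinearMap.isUnit_iff_ker_eq_bot, LinearMap.ker_eq_bot']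
  intro u hu
  by_contra h
  have := hH u h
  simp [hu] at this

theorem H_Hinv (P : TVData M N Z) (hH : ∀ u : ImgX M N, u ≠ 0 → 0 < inner ℝ (P.H u) u)
    (w : ImgX M N) : P.H (P.Hinv w) = w := by
  have h := Ring.mul_inverse_cancel _ (P.isUnit_H hH)
  exact LinearMap.congr_fun h w

theorem inner_Hinv_comm (P : TVData M N Z)
    (hH : ∀ u : ImgX M N, u ≠ 0 → 0 < inner ℝ (P.H u) u) (v w : ImgX M N) :
    inner ℝ (P.Hinv v) w = inner ℝ v (P.Hinv w) := by
  conv_lhs => rw [← P.H_Hinv hH w]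
  conv_rhs => rw [← P.H_Hinv hH v]
  exact (P.inner_H_comm _ _).symm

theorem inner_Hinv_pos (P : TVData M N Z)
    (hH : ∀ u : ImgX M N, u ≠ 0 → 0 < inner ℝ (P.H u) u) (w : ImgX M N) (hw : w ≠ 0) :
    0 < inner ℝ (P.Hinv w) w := by
  have h : P.Hinv w ≠ 0 := by
    intro h
    apply hw
    rw [← P.H_Hinv hH w, h, map_zero]
  have := hH _ h
  rwa [P.H_Hinv hH, real_inner_comm] at this

/-- Expansion of the Lagrangian `D u + ⟨m, ∇ u⟩` at its critical point. -/
theorem D_add_inner_grad (P : TVData M N Z) {m : ImgY M N} {w : ImgX M N}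
    (hw : P.H w = discDiv M N m + P.f) (u : ImgX M N) :
    P.D u + inner ℝ m (grad M N u) =
      P.D w + inner ℝ m (grad M N w) + inner ℝ (P.H (u - w)) (u - w) / 2 := by
  obtain ⟨v, rfl⟩ : ∃ v, u = w + v := ⟨u - w, by abel⟩
  have h1 : inner ℝ (P.H w) v = -inner ℝ m (grad M N v) + inner ℝ P.z (P.K v) := by
    rw [hw, inner_add_left, inner_discDiv_left, f, LinearMap.adjoint_inner_left]
  rw [inner_H_left] at h1
  have h2 : P.K (w + v) - P.z = (P.K w - P.z) + P.K v := by rw [map_add]; abel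
  have h3 : inner ℝ (P.K w - P.z) (P.K v) = inner ℝ (P.K w) (P.K v) - inner ℝ P.z (P.K v) :=
    inner_sub_left _ _ _
  rw [add_sub_cancel_left, inner_H_left, D, D, h2, map_add, norm_add_sq_real, norm_add_sq_real,
    inner_add_right, h3, real_inner_self_eq_norm_sq, real_inner_self_eq_norm_sq]
  linear_combination h1

theorem dualGrad_eq (P : TVData M N Z) (lam : ImgY M N) :
    P.dualGrad lam = -grad M N (P.Hinv (discDiv M N lam + P.f)) := by
  rw [dualGrad, adjoint_discDiv_apply]

theorem continuous_dualGrad (P : TVData M N Z) : Continuous P.dualGrad := by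
  unfold dualGrad
  exact (continuous_linearMap _).comp ((continuous_linearMap P.Hinv).comp
    ((continuous_linearMap (discDiv M N)).add continuous_const))

theorem continuous_dualSmooth (P : TVData M N Z) : Continuous P.dualSmooth := by
  unfold dualSmooth
  have h : Continuous fun lam => discDiv M N lam + P.f :=
    (continuous_linearMap (discDiv M N)).add continuous_const
  exact ((((continuous_linearMap P.Hinv).comp h).inner h).div_const _).sub continuous_const

theorem inner_dualGrad_sub (P : TVData M N Z) (a b v : ImgY M N) :
    inner ℝ (P.dualGrad a - P.dualGrad b) v =
      inner ℝ (P.Hinv (discDiv M N (a - b))) (discDiv M N v) := by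
  rw [dualGrad, dualGrad, ← map_sub, LinearMap.adjoint_inner_left, ← map_sub,
    add_sub_add_right_eq_sub, ← map_sub]

theorem dualSmooth_expand (P : TVData M N Z)
    (hH : ∀ u : ImgX M N, u ≠ 0 → 0 < inner ℝ (P.H u) u) (a b : ImgY M N) :
    P.dualSmooth b = P.dualSmooth a + inner ℝ (P.dualGrad a) (b - a) +
      inner ℝ (P.Hinv (discDiv M N (b - a))) (discDiv M N (b - a)) / 2 := by
  obtain ⟨v, rfl⟩ : ∃ v, b = a + v := ⟨b - a, by abel⟩
  have h : discDiv M N (a + v) + P.f = (discDiv M N a + P.f) + discDiv M N v := by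
    rw [map_add]; abel
  rw [add_sub_cancel_left, dualSmooth, dualSmooth, dualGrad, LinearMap.adjoint_inner_left, h]
  generalize discDiv M N a + P.f = c
  rw [map_add, inner_add_left, inner_add_right, inner_add_right,
    P.inner_Hinv_comm hH (discDiv M N v), real_inner_comm _ (discDiv M N v)]
  ring

theorem inner_Hinv_nonneg (P : TVData M N Z)
    (hH : ∀ u : ImgX M N, u ≠ 0 → 0 < inner ℝ (P.H u) u) (w : ImgX M N) :
    0 ≤ inner ℝ (P.Hinv w) w := by
  rcases eq_or_ne w 0 with rfl | hw
  · simp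
  · exact (P.inner_Hinv_pos hH w hw).le

theorem dualSmooth_ge (P : TVData M N Z)
    (hH : ∀ u : ImgX M N, u ≠ 0 → 0 < inner ℝ (P.H u) u) (a b : ImgY M N) :
    P.dualSmooth a + inner ℝ (P.dualGrad a) (b - a) ≤ P.dualSmooth b := by
  rw [P.dualSmooth_expand hH a b]
  have := P.inner_Hinv_nonneg hH (discDiv M N (b - a))
  linarith

/-! The dual function, its minimisers and its subdifferential. -/

theorem d_of_mem (P : TVData M N Z) {lam : ImgY M N} (h : lam ∈ isoBall M N P.α) :
    P.d lam = (P.dualSmooth lam : EReal) := by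
  simp [d, indicatorE, h]

theorem d_of_not_mem (P : TVData M N Z) {lam : ImgY M N} (h : lam ∉ isoBall M N P.α) :
    P.d lam = ⊤ := by
  simp [d, indicatorE, h]

theorem mem_subdiff_d_iff (P : TVData M N Z) (lam y : ImgY M N) :
    y ∈ subdiff P.d lam ↔ lam ∈ isoBall M N P.α ∧
      ∀ m ∈ isoBall M N P.α, P.dualSmooth lam + inner ℝ y (m - lam) ≤ P.dualSmooth m := by
  constructor
  · rintro ⟨h1, h2⟩
    have hl : lam ∈ isoBall M N P.α := by
      by_contra h
      exact h1 (P.d_of_not_mem h)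
    refine ⟨hl, fun m hm => ?_⟩
    have := h2 m
    rw [P.d_of_mem hl, P.d_of_mem hm] at this
    exact_mod_cast this
  · rintro ⟨hl, h2⟩
    refine ⟨by rw [P.d_of_mem hl]; exact EReal.coe_ne_top _, fun m => ?_⟩
    by_cases hm : m ∈ isoBall M N P.α
    · rw [P.d_of_mem hl, P.d_of_mem hm]
      exact_mod_cast h2 m hm
    · rw [P.d_of_not_mem hm]
      exact le_top

theorem mem_dualSol_iff (P : TVData M N Z) (hα : 0 < P.α) (lam : ImgY M N) :
    lam ∈ P.dualSol ↔ lam ∈ isoBall M N P.α ∧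
      ∀ m ∈ isoBall M N P.α, P.dualSmooth lam ≤ P.dualSmooth m := by
  constructor
  · intro h
    have hl : lam ∈ isoBall M N P.α := by
      by_contra hl
      have := h 0
      rw [P.d_of_not_mem hl, P.d_of_mem (zero_mem_isoBall hα.le), top_le_iff] at this
      exact EReal.coe_ne_top _ this
    refine ⟨hl, fun m hm => ?_⟩
    have := h m
    rw [P.d_of_mem hl, P.d_of_mem hm] at this
    exact_mod_cast this
  · rintro ⟨hl, h2⟩ m
    by_cases hm : m ∈ isoBall M N P.α
    · rw [P.d_of_mem hl, P.d_of_mem hm]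
      exact_mod_cast h2 m hm
    · rw [P.d_of_not_mem hm]
      exact le_top

theorem zero_mem_subdiff_d_iff (P : TVData M N Z) (hα : 0 < P.α) (lam : ImgY M N) :
    0 ∈ subdiff P.d lam ↔ lam ∈ P.dualSol := by
  simp [mem_subdiff_d_iff, mem_dualSol_iff _ hα]

/-- Subgradients of `d` satisfy the variational inequality. -/
theorem inner_sub_dualGrad_nonpos (P : TVData M N Z)
    (hH : ∀ u : ImgX M N, u ≠ 0 → 0 < inner ℝ (P.H u) u) {lam y m : ImgY M N}
    (h : y ∈ subdiff P.d lam) (hm : m ∈ isoBall M N P.α) :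
    inner ℝ (y - P.dualGrad lam) (m - lam) ≤ 0 := by
  rw [mem_subdiff_d_iff] at h
  have h0 : 0 ≤ inner ℝ (P.dualGrad lam - y) (m - lam) := by
    refine nonneg_of_forall_quadratic_nonneg
      (b := inner ℝ (P.Hinv (discDiv M N (m - lam))) (discDiv M N (m - lam)) / 2) ?_
    intro t ht ht1
    have hmt : lam + t • (m - lam) ∈ isoBall M N P.α :=
      (convex_isoBall P.α).add_smul_sub_mem h.1 hm ⟨ht.le, ht1⟩
    have h2 := h.2 _ hmt
    rw [P.dualSmooth_expand hH lam (lam + t • (m - lam)), add_sub_cancel_left] at h2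
    simp only [map_smul, inner_smul_left, inner_smul_right, RCLike.conj_to_real] at h2
    rw [inner_sub_left]
    linear_combination h2
  rw [← neg_sub, inner_neg_left]
  linarith

theorem inner_dualGrad_nonneg (P : TVData M N Z) (hα : 0 < P.α)
    (hH : ∀ u : ImgX M N, u ≠ 0 → 0 < inner ℝ (P.H u) u) {lam m : ImgY M N}
    (h : lam ∈ P.dualSol) (hm : m ∈ isoBall M N P.α) :
    0 ≤ inner ℝ (P.dualGrad lam) (m - lam) := by
  have := P.inner_sub_dualGrad_nonpos hH ((P.zero_mem_subdiff_d_iff hα lam).2 h) hm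
  rw [zero_sub, inner_neg_left] at this
  linarith

theorem mem_dualSol_of_inner_nonneg (P : TVData M N Z) (hα : 0 < P.α)
    (hH : ∀ u : ImgX M N, u ≠ 0 → 0 < inner ℝ (P.H u) u) {lam : ImgY M N}
    (hl : lam ∈ isoBall M N P.α)
    (h : ∀ m ∈ isoBall M N P.α, 0 ≤ inner ℝ (P.dualGrad lam) (m - lam)) : lam ∈ P.dualSol := by
  refine (P.mem_dualSol_iff hα lam).2 ⟨hl, fun m hm => ?_⟩
  have := P.dualSmooth_ge hH lam m
  linarith [h m hm]

theorem dualSol_nonempty (P : TVData M N Z) (hα : 0 < P.α) : P.dualSol.Nonempty := by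
  obtain ⟨m, hm, hmin⟩ := (isCompact_isoBall P.α).exists_isMinOn
    ⟨_, zero_mem_isoBall (M := M) (N := N) hα.le⟩ P.continuous_dualSmooth.continuousOn
  exact ⟨m, (P.mem_dualSol_iff hα m).2 ⟨hm, fun v hv => hmin hv⟩⟩

theorem isCompact_dualSol (P : TVData M N Z) (hα : 0 < P.α) : IsCompact P.dualSol := by
  have h : P.dualSol = isoBall M N P.α ∩
      ⋂ m ∈ isoBall M N P.α, {lam | P.dualSmooth lam ≤ P.dualSmooth m} := by
    ext lam
    simp [P.mem_dualSol_iff hα]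
  rw [h]
  exact (isCompact_isoBall P.α).inter_right
    (isClosed_biInter fun m _ => isClosed_le P.continuous_dualSmooth continuous_const)

/-- The gradient of the smooth part is constant on the solution set. -/
theorem discDiv_eq_of_mem_dualSol (P : TVData M N Z) (hα : 0 < P.α)
    (hH : ∀ u : ImgX M N, u ≠ 0 → 0 < inner ℝ (P.H u) u) {a b : ImgY M N}
    (ha : a ∈ P.dualSol) (hb : b ∈ P.dualSol) : discDiv M N a = discDiv M N b := by
  -- The two optimality conditions, tested against each other, contradict strict monotonicity in
  -- `Div` unless the divergences agree.
  have h1 := P.inner_dualGrad_nonneg hα hH ha ((P.mem_dualSol_iff hα b).1 hb).1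
  have h2 := P.inner_dualGrad_nonneg hα hH hb ((P.mem_dualSol_iff hα a).1 ha).1
  have h3 := P.inner_dualGrad_sub a b (a - b)
  by_contra h
  have h4 := P.inner_Hinv_pos hH (discDiv M N (a - b)) (by rwa [map_sub, sub_ne_zero])
  rw [inner_sub_left] at h3
  rw [← neg_sub, inner_neg_right] at h1
  linarith

/-! The proximal point of `d` and the gap of the reduced augmented Lagrangian. -/

/-- `m` is the proximal point of `d` at `lam` with step size `s`, in variational form. -/
def IsProx (P : TVData M N Z) (s : ℝ) (lam m : ImgY M N) : Prop :=
  m ∈ isoBall M N P.α ∧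
    ∀ v ∈ isoBall M N P.α, 0 ≤ inner ℝ (P.dualGrad m + s⁻¹ • (m - lam)) (v - m)

theorem exists_isProx (P : TVData M N Z) (hα : 0 < P.α)
    (hH : ∀ u : ImgX M N, u ≠ 0 → 0 < inner ℝ (P.H u) u) (s : ℝ) (lam : ImgY M N) :
    ∃ m, P.IsProx s lam m := by
  obtain ⟨m, hm, hmin⟩ := (isCompact_isoBall P.α).exists_isMinOn
    ⟨_, zero_mem_isoBall (M := M) (N := N) hα.le⟩
    (f := fun m => P.dualSmooth m + s⁻¹ * (‖m - lam‖ ^ 2 / 2))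
    (P.continuous_dualSmooth.add (by fun_prop)).continuousOn
  refine ⟨m, hm, fun v hv => ?_⟩
  refine nonneg_of_forall_quadratic_nonneg
      (b := inner ℝ (P.Hinv (discDiv M N (v - m))) (discDiv M N (v - m)) / 2 +
        s⁻¹ * (‖v - m‖ ^ 2 / 2)) ?_
  intro t ht ht1
  have hmt : m + t • (v - m) ∈ isoBall M N P.α :=
    (convex_isoBall P.α).add_smul_sub_mem hm hv ⟨ht.le, ht1⟩
  have h2 : P.dualSmooth m + s⁻¹ * (‖m - lam‖ ^ 2 / 2) ≤
      P.dualSmooth (m + t • (v - m)) + s⁻¹ * (‖m + t • (v - m) - lam‖ ^ 2 / 2) := hmin hmt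
  have h3 : m + t • (v - m) - lam = (m - lam) + t • (v - m) := by abel
  rw [P.dualSmooth_expand hH m (m + t • (v - m)), add_sub_cancel_left, h3, norm_add_sq_real, norm_smul, mul_pow,
    Real.norm_eq_abs, sq_abs] at h2
  simp only [map_smul, inner_smul_left, inner_smul_right, RCLike.conj_to_real] at h2
  simp only [inner_add_left, inner_smul_left, RCLike.conj_to_real]
  linear_combination h2

/-- Supplies the subgradient to which metric subregularity is applied in the rate estimate. -/
theorem IsProx.mem_subdiff {P : TVData M N Z}
    (hH : ∀ u : ImgX M N, u ≠ 0 → 0 < inner ℝ (P.H u) u) {s : ℝ} {lam m : ImgY M N}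
    (h : P.IsProx s lam m) : s⁻¹ • (lam - m) ∈ subdiff P.d m := by
  refine (P.mem_subdiff_d_iff _ _).2 ⟨h.1, fun v hv => ?_⟩
  have h1 := h.2 v hv
  have h2 := P.dualSmooth_ge hH m v
  rw [← neg_sub lam m, smul_neg, inner_add_left, inner_neg_left] at h1
  linarith

/-- The proximal map of `d` is firmly quasi-nonexpansive. -/
theorem IsProx.norm_sq_add_le {P : TVData M N Z} (hα : 0 < P.α)
    (hH : ∀ u : ImgX M N, u ≠ 0 → 0 < inner ℝ (P.H u) u) {s : ℝ} (hs : 0 < s)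
    {lam m v : ImgY M N} (h : P.IsProx s lam m) (hv : v ∈ P.dualSol) :
    ‖m - v‖ ^ 2 + ‖m - lam‖ ^ 2 ≤ ‖lam - v‖ ^ 2 := by
  have hv' := (P.mem_dualSol_iff hα v).1 hv
  have h1 := h.2 v hv'.1
  have h2 := P.dualSmooth_ge hH m v
  have h3 := hv'.2 m h.1
  rw [inner_add_left, inner_smul_left, RCLike.conj_to_real] at h1
  -- Since `v` minimises the dual objective, the gradient term in the variational inequality is
  -- nonpositive. The remaining angle condition gives the Pythagorean inequality.
  have h4 : 0 ≤ inner ℝ (m - lam) (v - m) := by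
    have : 0 ≤ s⁻¹ * inner ℝ (m - lam) (v - m) := by linarith
    exact nonneg_of_mul_nonneg_right this (inv_pos.2 hs)
  have h5 : lam - v = -((m - lam) + (v - m)) := by abel
  rw [h5, norm_neg, norm_add_sq_real, norm_sub_rev m v]
  linarith

omit [FiniteDimensional ℝ Z] in
theorem pOf_eq (P : TVData M N Z) (hα : 0 < P.α) {s : ℝ} (hs : 0 < s) (lam : ImgY M N)
    (u : ImgX M N) :
    lam + s • grad M N u = isoProj P.α (lam + s • grad M N u) + s • P.pOf s lam u := by
  have h : s⁻¹ • lam + grad M N u = s⁻¹ • (lam + s • grad M N u) := by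
    rw [smul_add, inv_smul_smul₀ hs.ne']
  rw [pOf, h, isoProj_add_smul_softThr hα hs]

-- With `m` the projection, complementarity turns `α ‖p‖₁` into `⟨m, p⟩`, and `s (∇u - p) = m - λ`.
-- So `p` disappears, and `Φ` is the value at its maximiser over the ball of a function concave in
-- `m`.
omit [FiniteDimensional ℝ Z] in
theorem Phi_eq (P : TVData M N Z) (hα : 0 < P.α) {s : ℝ} (hs : 0 < s) (lam : ImgY M N)
    (u : ImgX M N) :
    P.Phi s lam u = P.D u + inner ℝ (isoProj P.α (lam + s • grad M N u)) (grad M N u) -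
      ‖isoProj P.α (lam + s • grad M N u) - lam‖ ^ 2 / (2 * s) := by
  have h1 := P.pOf_eq hα hs lam u
  have h2 : inner ℝ (isoProj P.α (lam + s • grad M N u)) (P.pOf s lam u) =
      P.α * isoNorm1 (P.pOf s lam u) := by
    have h : s⁻¹ • lam + grad M N u = s⁻¹ • (lam + s • grad M N u) := by
      rw [smul_add, inv_smul_smul₀ hs.ne']
    rw [pOf, h, inner_isoProj_softThr hα hs]
  rw [Phi, augL, ← h2]
  generalize isoProj P.α (lam + s • grad M N u) = m at *
  generalize P.pOf s lam u = p at *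
  have h3 : s • (grad M N u - p) = m - lam := by
    rw [smul_sub, sub_eq_sub_iff_add_eq_add, add_comm, h1]
  have h4 : grad M N u = p + (grad M N u - p) := by abel
  generalize grad M N u - p = r at *
  obtain rfl : m = lam + s • r := by rw [h3]; abel
  rw [h4, add_sub_cancel_left, norm_smul, mul_pow, Real.norm_eq_abs, sq_abs, inner_add_right]
  simp only [inner_add_left, inner_smul_left, RCLike.conj_to_real, real_inner_self_eq_norm_sq]
  field_simp
  ring

/-- The gap of the reduced augmented Lagrangian controls the distances to the exact update. -/
theorem IsProx.gap_le {P : TVData M N Z} (hα : 0 < P.α)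
    (hH : ∀ u : ImgX M N, u ≠ 0 → 0 < inner ℝ (P.H u) u) {s : ℝ} (hs : 0 < s)
    {lam m : ImgY M N} (h : P.IsProx s lam m) (u : ImgX M N) :
    inner ℝ (P.H (u - P.Hinv (discDiv M N m + P.f))) (u - P.Hinv (discDiv M N m + P.f)) / 2 +
      ‖isoProj P.α (lam + s • grad M N u) - m‖ ^ 2 / (2 * s) ≤
      P.Phi s lam u - ⨅ v, P.Phi s lam v := by
  set w := P.Hinv (discDiv M N m + P.f) with hw
  have hHw : P.H w = discDiv M N m + P.f := P.H_Hinv hH _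
  -- The variational inequality of the proximal point says exactly that `m` is this projection: `(w,
  -- m)` is a saddle point.
  have hm : isoProj P.α (lam + s • grad M N w) = m := by
    refine isoProj_eq_of_inner_nonpos hα h.1 fun v hv => ?_
    have h1 := h.2 v hv
    rw [dualGrad_eq, ← hw] at h1
    have h2 : lam + s • grad M N w - m = (-s) • (-grad M N w + s⁻¹ • (m - lam)) := by
      rw [smul_add, smul_smul, neg_mul, mul_inv_cancel₀ hs.ne', neg_smul, neg_smul, smul_neg]
      simp only [one_smul]
      abel
    rw [h2, inner_smul_left, RCLike.conj_to_real]
    nlinarith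
  -- The first term is the exact quadratic growth of the Lagrangian in `u`; the second is its strong
  -- concavity in the multiplier.
  have key : ∀ u, inner ℝ (P.H (u - w)) (u - w) / 2 +
      ‖isoProj P.α (lam + s • grad M N u) - m‖ ^ 2 / (2 * s) ≤
      P.Phi s lam u - P.Phi s lam w := by
    intro u
    have h1 := inner_sub_isoProj_nonpos hα (lam + s • grad M N u) h.1
    have h2 := P.D_add_inner_grad hHw u
    rw [P.Phi_eq hα hs lam u, P.Phi_eq hα hs lam w, hm]
    generalize isoProj P.α (lam + s • grad M N u) = n at *
    have h3 : ‖n - m‖ ^ 2 + ‖n - lam‖ ^ 2 - ‖m - lam‖ ^ 2 =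
        2 * inner ℝ (lam - n) (m - n) := by
      have e : m - lam = (m - n) - (lam - n) := by abel
      rw [e, norm_sub_sq_real (m - n), norm_sub_rev n m, norm_sub_rev n lam,
        real_inner_comm (lam - n)]
      ring
    have h4 : inner ℝ (lam - n) (m - n) ≤ s * (inner ℝ n (grad M N u) - inner ℝ m (grad M N u)) := by
      have e : lam + s • grad M N u - n = (lam - n) + s • grad M N u := by abel
      rw [e, inner_add_left, inner_smul_left, RCLike.conj_to_real, inner_sub_right (grad M N u),
        real_inner_comm m, real_inner_comm n] at h1
      linarith
    have h5 : ‖n - m‖ ^ 2 / (2 * s) + ‖n - lam‖ ^ 2 / (2 * s) - ‖m - lam‖ ^ 2 / (2 * s) ≤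
        inner ℝ n (grad M N u) - inner ℝ m (grad M N u) := by
      rw [← add_div, ← sub_div, h3, div_le_iff₀ (by positivity)]
      linarith
    linarith
  -- The left side of `key` is nonnegative, so `w` attains the infimum.
  have hinf : ⨅ v, P.Phi s lam v = P.Phi s lam w := by
    have hle : ∀ v, P.Phi s lam w ≤ P.Phi s lam v := fun v => by
      have := key v
      have h1 := P.inner_H_nonneg hH (v - w)
      have h2 : 0 ≤ ‖isoProj P.α (lam + s • grad M N v) - m‖ ^ 2 / (2 * s) := by positivity
      linarith
    exact le_antisymm (ciInf_le ⟨_, Set.forall_mem_range.2 hle⟩ w) (le_ciInf hle)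
  rw [hinf]
  exact key u

/-- Dual solutions yield primal solutions. -/
theorem primal_le_of_mem_dualSol (P : TVData M N Z) (hα : 0 < P.α)
    (hH : ∀ u : ImgX M N, u ≠ 0 → 0 < inner ℝ (P.H u) u) {lam : ImgY M N}
    (h : lam ∈ P.dualSol) (v : ImgX M N) :
    P.primal (P.Hinv (discDiv M N lam + P.f)) ≤ P.primal v := by
  have hl := ((P.mem_dualSol_iff hα lam).1 h).1
  set w := P.Hinv (discDiv M N lam + P.f) with hw
  have h1 := P.D_add_inner_grad (P.H_Hinv hH (discDiv M N lam + P.f)) v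
  rw [← hw] at h1
  have h2 := inner_le_mul_isoNorm1 hl (grad M N v)
  have hpos := P.inner_H_nonneg hH (v - w)
  -- Dual certificate of `α ‖∇w‖₁`; it is zero where `∇w` vanishes. Optimality of `lam` against it
  -- gives `⟨lam, ∇w⟩ ≥ α ‖∇w‖₁`.
  set m : ImgY M N := WithLp.toLp 2 fun x => (P.α / ‖grad M N w x‖) • grad M N w x with hm
  have hmem : m ∈ isoBall M N P.α := fun x => by
    simp only [hm, norm_smul, norm_div, norm_norm, Real.norm_of_nonneg hα.le]
    rcases eq_or_ne (grad M N w x) 0 with h0 | h0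
    · simp [h0, hα.le]
    · rw [div_mul_cancel₀ _ (norm_ne_zero_iff.2 h0)]
  have hval : inner ℝ m (grad M N w) = P.α * isoNorm1 (grad M N w) := by
    rw [PiLp.inner_apply, isoNorm1, Finset.mul_sum]
    refine Finset.sum_congr rfl fun x _ => ?_
    simp only [hm, inner_smul_left, RCLike.conj_to_real, real_inner_self_eq_norm_sq]
    rcases eq_or_ne (grad M N w x) 0 with h0 | h0
    · simp [h0]
    · have := norm_ne_zero_iff.2 h0
      field_simp
  have h3 := P.inner_dualGrad_nonneg hα hH h hmem
  rw [dualGrad_eq, ← hw, inner_neg_left, inner_sub_right, real_inner_comm m,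
    real_inner_comm lam, hval] at h3
  rw [primal, primal]
  linarith

end TVData

/-! ### Quasi-Fejér convergence. -/

theorem exists_tendsto_of_le_add_summable {a ε : ℕ → ℝ} (ha : ∀ k, 0 ≤ a k)
    (hε0 : ∀ k, 0 ≤ ε k) (hε : Summable ε) (h : ∀ k, a (k + 1) ≤ a k + ε k) :
    ∃ l, Tendsto a atTop (𝓝 l) := by
  -- Subtracting the accumulated errors leaves a decreasing sequence that is bounded below.
  have hanti : Antitone fun k => a k - ∑ i ∈ Finset.range k, ε i := antitone_nat_of_succ_le
    fun k => by rw [Finset.sum_range_succ]; linarith [h k]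
  have hbdd : BddBelow (Set.range fun k => a k - ∑ i ∈ Finset.range k, ε i) := by
    refine ⟨-∑' i, ε i, Set.forall_mem_range.2 fun k => ?_⟩
    have := hε.sum_le_tsum (Finset.range k) fun i _ => hε0 i
    linarith [ha k]
  have h1 := (tendsto_atTop_ciInf hanti hbdd).add hε.hasSum.tendsto_sum_nat
  exact ⟨_, by simpa using h1⟩

/-- Convergence of inexact iterations of a firmly quasi-nonexpansive map whose asymptotic fixed
points lie in `S`. -/
theorem exists_tendsto_of_quasiFejer {E : Type*} [NormedAddCommGroup E] {S K : Set E}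
    (hK : IsCompact K) (hS : S.Nonempty) {x J : ℕ → E} {ε : ℕ → ℝ} (hε0 : ∀ k, 0 ≤ ε k)
    (hε : Summable ε) (hJ : ∀ k, J k ∈ K)
    (hfej : ∀ k, ∀ s ∈ S, ‖J k - s‖ ^ 2 + ‖J k - x k‖ ^ 2 ≤ ‖x k - s‖ ^ 2)
    (hstep : ∀ k, ‖x (k + 1) - J k‖ ≤ ε k)
    (hclosed : Tendsto (fun k => J k - x k) atTop (𝓝 0) → ∀ (φ : ℕ → ℕ) (s : E),
      StrictMono φ → s ∈ K → Tendsto (J ∘ φ) atTop (𝓝 s) → s ∈ S) :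
    ∃ s ∈ S, Tendsto x atTop (𝓝 s) ∧ Tendsto J atTop (𝓝 s) := by
  have hle : ∀ k, ∀ s ∈ S, ‖J k - s‖ ≤ ‖x k - s‖ := fun k s hs =>
    le_of_sq_le_sq (by nlinarith [hfej k s hs, sq_nonneg ‖J k - x k‖]) (norm_nonneg _)
  have hge : ∀ k s, ‖x (k + 1) - s‖ - ε k ≤ ‖J k - s‖ := fun k s => by
    have h1 := norm_add_le (x (k + 1) - J k) (J k - s)
    rw [sub_add_sub_cancel] at h1
    linarith [hstep k]
  have hlim : ∀ s ∈ S, ∃ l, Tendsto (fun k => ‖x k - s‖) atTop (𝓝 l) := fun s hs =>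
    exists_tendsto_of_le_add_summable (fun k => norm_nonneg _) hε0 hε fun k => by
      linarith [hge k s, hle k s hs]
  -- `‖J k - s‖` is squeezed to the limit of `‖x k - s‖`, so the decrease in `hfej` vanishes.
  have hJx : Tendsto (fun k => J k - x k) atTop (𝓝 0) := by
    obtain ⟨s, hs⟩ := hS
    obtain ⟨l, hl⟩ := hlim s hs
    have h1 : Tendsto (fun k => ‖J k - s‖) atTop (𝓝 l) := by
      refine tendsto_of_tendsto_of_tendsto_of_le_of_le ?_ hl (fun k => hge k s)
        fun k => hle k s hs
      simpa using ((tendsto_add_atTop_iff_nat 1).2 hl).sub hε.tendsto_atTop_zero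
    have h2 : Tendsto (fun k => ‖J k - x k‖ ^ 2) atTop (𝓝 0) := by
      refine squeeze_zero (fun k => sq_nonneg _) (g := fun k => ‖x k - s‖ ^ 2 - ‖J k - s‖ ^ 2)
        (fun k => by linarith [hfej k s hs]) ?_
      simpa using (hl.pow 2).sub (h1.pow 2)
    rw [tendsto_zero_iff_norm_tendsto_zero]
    simpa using h2.sqrt
  obtain ⟨s, hsK, φ, hφ, hs⟩ := hK.tendsto_subseq hJ
  have hsS := hclosed hJx φ s hφ hsK hs
  obtain ⟨l, hl⟩ := hlim s hsS
  have h1 : Tendsto (fun k => x (φ k)) atTop (𝓝 s) := by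
    simpa using hs.sub (hJx.comp hφ.tendsto_atTop)
  have h2 : Tendsto (fun k => ‖x (φ k) - s‖) atTop (𝓝 0) := by
    simpa using (h1.sub_const s).norm
  -- The distance to the cluster point `s` converges along the full sequence, and to zero along a
  -- subsequence.
  have hl0 : l = 0 := tendsto_nhds_unique (hl.comp hφ.tendsto_atTop) h2
  have hx : Tendsto x atTop (𝓝 s) := by
    rw [tendsto_iff_norm_sub_tendsto_zero, ← hl0]; exact hl
  exact ⟨s, hsS, hx, by simpa using hx.add hJx⟩

/-! ### Error bound and metric subregularity under nondegeneracy. -/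

/-- Linear maps in finite dimensions have preimages of proportional norm. -/
theorem LinearMap.exists_preimage_norm_le_of_finiteDimensional {E F : Type*}
    [NormedAddCommGroup E] [NormedSpace ℝ E] [FiniteDimensional ℝ E]
    [NormedAddCommGroup F] [NormedSpace ℝ F] (T : E →ₗ[ℝ] F) :
    ∃ C > 0, ∀ v, ∃ w, T w = T v ∧ ‖w‖ ≤ C * ‖T v‖ := by
  obtain ⟨S, hS⟩ := T.rangeRestrict.exists_rightInverse_of_surjective T.range_rangeRestrict
  obtain ⟨C, hC, hb⟩ := (LinearMap.toContinuousLinearMap S).bound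
  refine ⟨C, hC, fun v => ⟨S (T.rangeRestrict v), ?_, hb (T.rangeRestrict v)⟩⟩
  exact congrArg Subtype.val (LinearMap.congr_fun hS (T.rangeRestrict v))

/-- Quadratic growth of linear functionals on a disc at a minimiser. -/
theorem norm_mul_norm_sub_sq_le {V : Type*} [NormedAddCommGroup V] [InnerProductSpace ℝ V]
    {a : ℝ} (ha : 0 < a) {g v w : V} (hv : ‖v‖ ≤ a) (hw : ‖w‖ ≤ a)
    (hg : inner ℝ g w = -(a * ‖g‖)) : ‖g‖ * ‖v - w‖ ^ 2 ≤ 2 * a * inner ℝ g (v - w) := by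
  rcases eq_or_ne g 0 with rfl | h0
  · simp
  have hn : 0 < ‖g‖ := norm_pos_iff.2 h0
  have hwa : ‖w‖ = a := by
    refine le_antisymm hw ?_
    have h1 := neg_le_of_abs_le (abs_real_inner_le_norm g w)
    rw [hg] at h1
    nlinarith
  -- Equality in Cauchy-Schwarz: `w` is the boundary point opposite to `g`.
  have h1 : a • g + ‖g‖ • w = 0 := by
    rw [← norm_eq_zero, ← pow_eq_zero_iff two_ne_zero, norm_add_sq_real, norm_smul, norm_smul,
      inner_smul_left, inner_smul_right, hg, hwa, norm_norm, Real.norm_of_nonneg ha.le,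
      RCLike.conj_to_real]
    ring
  have h2 : a * inner ℝ g (v - w) = -(‖g‖ * inner ℝ w (v - w)) := by
    have := congrArg (fun z => inner ℝ z (v - w)) h1
    simp only [inner_add_left, inner_smul_left, RCLike.conj_to_real, inner_zero_left] at this
    linarith
  have h3 : ‖v - w‖ ^ 2 ≤ -(2 * inner ℝ w (v - w)) := by
    rw [inner_sub_right, real_inner_self_eq_norm_sq, norm_sub_sq_real, real_inner_comm w v, hwa]
    have := pow_le_pow_left₀ (norm_nonneg v) hv 2
    linarith
  nlinarith [mul_le_mul_of_nonneg_left h3 hn.le]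

namespace TVData

variable {M N : ℕ} {Z : Type*} [NormedAddCommGroup Z] [InnerProductSpace ℝ Z]
  [FiniteDimensional ℝ Z]

theorem dualGrad_congr (P : TVData M N Z) {a b : ImgY M N} (h : discDiv M N a = discDiv M N b) :
    P.dualGrad a = P.dualGrad b := by
  rw [dualGrad, dualGrad, h]

theorem mem_dualSol_of_discDiv_eq (P : TVData M N Z) (hα : 0 < P.α) {a b : ImgY M N}
    (hb : b ∈ P.dualSol) (ha : a ∈ isoBall M N P.α) (h : discDiv M N a = discDiv M N b) :
    a ∈ P.dualSol := by
  have h1 : P.dualSmooth a = P.dualSmooth b := by rw [dualSmooth, dualSmooth, h]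
  exact (P.mem_dualSol_iff hα a).2 ⟨ha, fun m hm => h1 ▸ ((P.mem_dualSol_iff hα b).1 hb).2 m hm⟩

/-- Complementarity at dual solutions. -/
theorem inner_dualGrad_apply (P : TVData M N Z) (hα : 0 < P.α)
    (hH : ∀ u : ImgX M N, u ≠ 0 → 0 < inner ℝ (P.H u) u) {lam : ImgY M N}
    (h : lam ∈ P.dualSol) (x : Fin M × Fin N) :
    inner ℝ (P.dualGrad lam x) (lam x) = -(P.α * ‖P.dualGrad lam x‖) := by
  have hl := ((P.mem_dualSol_iff hα lam).1 h).1
  set g := P.dualGrad lam with hg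
  set m : ImgY M N := WithLp.toLp 2 fun x => (-(P.α / ‖g x‖)) • g x with hm
  have hmem : m ∈ isoBall M N P.α := fun x => by
    simp only [hm, norm_smul, norm_neg, norm_div, norm_norm, Real.norm_of_nonneg hα.le]
    rcases eq_or_ne (g x) 0 with h0 | h0
    · simp [h0, hα.le]
    · rw [div_mul_cancel₀ _ (norm_ne_zero_iff.2 h0)]
  have hval : ∀ x, inner ℝ (g x) (m x) = -(P.α * ‖g x‖) := fun x => by
    simp only [hm, inner_smul_right, real_inner_self_eq_norm_sq]
    rcases eq_or_ne (g x) 0 with h0 | h0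
    · simp [h0]
    · have := norm_ne_zero_iff.2 h0
      field_simp
  have h1 := P.inner_dualGrad_nonneg hα hH h hmem
  rw [← hg, inner_sub_right, PiLp.inner_apply, PiLp.inner_apply, ← Finset.sum_sub_distrib] at h1
  -- `m` minimises the pairing with `g` at every pixel. By optimality the sum of these nonpositive
  -- terms is nonnegative, so each vanishes.
  have h2 : ∀ x ∈ Finset.univ, inner ℝ (g x) (m x) - inner ℝ (g x) (lam x) ≤ 0 := fun x _ => by
    have h3 := neg_le_of_abs_le (abs_real_inner_le_norm (g x) (lam x))
    have h4 := mul_le_mul_of_nonneg_left (hl x) (norm_nonneg (g x))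
    rw [hval]
    linarith
  have h3 := (Finset.sum_eq_zero_iff_of_nonpos h2).1 (le_antisymm (Finset.sum_nonpos h2) h1) x
    (Finset.mem_univ x)
  rw [hval] at h3
  linarith

/-- The residual `(Div v, (√|g x| v x)ₓ)`. -/
noncomputable def residual (g : ImgY M N) : ImgY M N →ₗ[ℝ] ImgX M N × ImgY M N :=
  (discDiv M N).prod
    { toFun := pixMul fun x => √‖g x‖
      map_add' := fun _ _ => PiLp.ext fun _ => smul_add _ _ _
      map_smul' := fun c v => PiLp.ext fun x => smul_comm (√‖g x‖) c (v x) }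

theorem norm_pixMul_sqrt_sq (g v : ImgY M N) :
    ‖pixMul (fun x => √‖g x‖) v‖ ^ 2 = ∑ x, ‖g x‖ * ‖v x‖ ^ 2 := by
  rw [PiLp.norm_sq_eq_of_L2]
  refine Finset.sum_congr rfl fun x _ => ?_
  simp [pixMul, norm_smul, mul_pow, abs_of_nonneg (Real.sqrt_nonneg _)]

theorem norm_pixMul_sqrt_sq_le (P : TVData M N Z) (hα : 0 < P.α)
    (hH : ∀ u : ImgX M N, u ≠ 0 → 0 < inner ℝ (P.H u) u) {lam v : ImgY M N}
    (h : lam ∈ P.dualSol) (hv : v ∈ isoBall M N P.α) :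
    ‖pixMul (fun x => √‖P.dualGrad lam x‖) (v - lam)‖ ^ 2 ≤
      2 * P.α * inner ℝ (P.dualGrad lam) (v - lam) := by
  rw [norm_pixMul_sqrt_sq, PiLp.inner_apply, Finset.mul_sum]
  exact Finset.sum_le_sum fun x _ => norm_mul_norm_sub_sq_le hα (hv x)
    (((P.mem_dualSol_iff hα lam).1 h).1 x) (P.inner_dualGrad_apply hα hH h x)

/-- Both solutions have the same `g`, hence by complementarity the same pairing with it, and the
quadratic growth bound becomes zero. -/
theorem residual_eq_of_mem_dualSol (P : TVData M N Z) (hα : 0 < P.α)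
    (hH : ∀ u : ImgX M N, u ≠ 0 → 0 < inner ℝ (P.H u) u) {a b : ImgY M N}
    (ha : a ∈ P.dualSol) (hb : b ∈ P.dualSol) :
    residual (P.dualGrad b) a = residual (P.dualGrad b) b := by
  have hD := P.discDiv_eq_of_mem_dualSol hα hH ha hb
  have h1 := P.norm_pixMul_sqrt_sq_le hα hH hb ((P.mem_dualSol_iff hα a).1 ha).1
  have h2 : inner ℝ (P.dualGrad b) (a - b) = 0 := by
    rw [inner_sub_right, PiLp.inner_apply, PiLp.inner_apply, sub_eq_zero]
    refine Finset.sum_congr rfl fun x _ => ?_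
    rw [P.inner_dualGrad_apply hα hH hb, ← P.dualGrad_congr hD, P.inner_dualGrad_apply hα hH ha]
  rw [h2, mul_zero] at h1
  have h3 : pixMul (fun x => √‖P.dualGrad b x‖) (a - b) = 0 :=
    norm_eq_zero.1 (pow_eq_zero_iff two_ne_zero |>.1 (le_antisymm h1 (sq_nonneg _)))
  rw [← sub_eq_zero, ← map_sub]
  exact Prod.ext (by simpa [residual, sub_eq_zero] using hD) h3

/-- Under nondegeneracy the residual is an error bound for the dual solution set. -/
theorem exists_infDist_dualSol_le_residual (P : TVData M N Z) (hα : 0 < P.α)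
    {lb : ImgY M N} (hlb : lb ∈ P.dualSol)
    (hint : ∀ x, P.dualGrad lb x = 0 → ‖lb x‖ < P.α) :
    ∃ C > 0, ∀ a ∈ isoBall M N P.α, Metric.infDist a P.dualSol ≤
      C * ‖residual (P.dualGrad lb) (a - lb)‖ := by
  obtain ⟨C, hC, hpre⟩ :=
    (residual (P.dualGrad lb)).exists_preimage_norm_le_of_finiteDimensional
  have hbl := ((P.mem_dualSol_iff hα lb).1 hlb).1
  obtain ⟨ρ, hρx, hρ⟩ : ∃ ρ : ℝ, (∀ x, P.dualGrad lb x = 0 → ‖lb x‖ ≤ P.α - ρ) ∧ 0 < ρ := by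
    have h1 : ∀ᶠ ρ : ℝ in 𝓝[>] 0, ∀ x, P.dualGrad lb x = 0 → ‖lb x‖ ≤ P.α - ρ := by
      refine eventually_all.2 fun x => ?_
      by_cases h0 : P.dualGrad lb x = 0
      · filter_upwards [Ioc_mem_nhdsGT (sub_pos.2 (hint x h0))] with ρ hρ _
        linarith [hρ.2]
      · exact Eventually.of_forall fun ρ h => absurd h h0
    exact (h1.and self_mem_nhdsWithin).exists
  obtain ⟨R, hR⟩ := (isCompact_isoBall (M := M) (N := N) P.α).isBounded.exists_norm_le
  have hR0 : 0 ≤ R := (norm_nonneg _).trans (hR _ hbl)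
  refine ⟨(2 * R / ρ + 2) * C, by positivity, fun a ha => ?_⟩
  -- `a - w` has exactly the residual of `lb`, but may leave each disc by up to `e = ‖w‖`.
  obtain ⟨w, hw, hwC⟩ := hpre (a - lb)
  set e := ‖w‖ with he
  have he0 : 0 ≤ e := norm_nonneg w
  -- Chosen so that `(1 - t) (α + e) + t (α - ρ) = α`: this move towards `lb` just restores
  -- feasibility at the pixels with slack `ρ`. At the other pixels `a - w` already equals `lb`.
  set t := e / (ρ + e) with ht
  have hpe : 0 < ρ + e := by positivity
  have ht0 : 0 ≤ t := by positivity
  have ht1 : t ≤ 1 := (div_le_one hpe).2 (by linarith)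
  have hte : t * (ρ + e) = e := div_mul_cancel₀ _ hpe.ne'
  have hker : residual (P.dualGrad lb) (lb - (a - w)) = 0 := by
    have : lb - (a - w) = w - (a - lb) := by abel
    rw [this, map_sub, hw, sub_self]
  have hdiv : discDiv M N (lb - (a - w)) = 0 := congrArg Prod.fst hker
  have hpix : ∀ x, √‖P.dualGrad lb x‖ • (lb x - (a x - w x)) = 0 := fun x => by
    have h2 : pixMul (fun x => √‖P.dualGrad lb x‖) (lb - (a - w)) = 0 := congrArg Prod.snd hker
    have h3 := congrArg (fun q : ImgY M N => q x) h2
    exact h3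
  set n := (a - w) + t • (lb - (a - w)) with hn
  have hnball : n ∈ isoBall M N P.α := fun x => by
    have hnx : n x = (a x - w x) + t • (lb x - (a x - w x)) := rfl
    rcases eq_or_ne (P.dualGrad lb x) 0 with h0 | h0
    · have h1 : n x = (1 - t) • (a x - w x) + t • lb x := by
        rw [hnx, smul_sub, sub_smul, one_smul]; abel
      have h2 : ‖a x - w x‖ ≤ P.α + e :=
        (norm_sub_le _ _).trans (add_le_add (ha x) (PiLp.norm_apply_le w x))
      rw [h1]
      refine (norm_add_le _ _).trans ?_
      rw [norm_smul, norm_smul, Real.norm_of_nonneg ht0, Real.norm_of_nonneg (sub_nonneg.2 ht1)]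
      have h3 := mul_le_mul_of_nonneg_left h2 (sub_nonneg.2 ht1)
      have h4 := mul_le_mul_of_nonneg_left (hρx x h0) ht0
      linarith
    · have h1 := (smul_eq_zero.1 (hpix x)).resolve_left
        (Real.sqrt_ne_zero'.2 (norm_pos_iff.2 h0))
      have h2 : n x = lb x := by
        rw [hnx, h1, smul_zero, add_zero]
        exact (sub_eq_zero.1 h1).symm
      rw [h2]
      exact hbl x
  have hnS : n ∈ P.dualSol := by
    refine P.mem_dualSol_of_discDiv_eq hα hlb hnball ?_
    rw [hn, map_add, map_smul, hdiv, smul_zero, add_zero]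
    rw [map_sub, sub_eq_zero] at hdiv
    exact hdiv.symm
  have h1 : dist a n ≤ e + t * (2 * R + e) := by
    have h2 : a - n = w - t • (lb - (a - w)) := by rw [hn]; abel
    have h3 : lb - (a - w) = lb - a + w := by abel
    rw [dist_eq_norm, h2]
    refine (norm_sub_le _ _).trans (add_le_add le_rfl ?_)
    rw [norm_smul, Real.norm_of_nonneg ht0, h3]
    refine mul_le_mul_of_nonneg_left ((norm_add_le _ _).trans (add_le_add ?_ le_rfl)) ht0
    refine (norm_sub_le _ _).trans ?_
    linarith [hR _ hbl, hR _ ha]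
  have h2 : t * (2 * R + e) ≤ (2 * R / ρ + 1) * e := by
    have h3 : 2 * R + e ≤ (2 * R / ρ + 1) * (ρ + e) := by
      have : (2 * R / ρ + 1) * (ρ + e) = 2 * R + ρ + 2 * R / ρ * e + e := by
        field_simp
        ring
      have h4 : 0 ≤ 2 * R / ρ * e := by positivity
      linarith
    calc t * (2 * R + e) ≤ t * ((2 * R / ρ + 1) * (ρ + e)) := mul_le_mul_of_nonneg_left h3 ht0
      _ = (2 * R / ρ + 1) * (t * (ρ + e)) := by ring
      _ = (2 * R / ρ + 1) * e := by rw [hte]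
  calc Metric.infDist a P.dualSol ≤ dist a n := Metric.infDist_le_dist_of_mem hnS
    _ ≤ (2 * R / ρ + 2) * e := by linarith
    _ ≤ (2 * R / ρ + 2) * (C * ‖residual (P.dualGrad lb) (a - lb)‖) :=
        mul_le_mul_of_nonneg_left hwC (by positivity)
    _ = _ := by ring

/-- Under nondegeneracy `∂d` satisfies a global error bound. -/
theorem Nondegenerate.exists_infDist_le {P : TVData M N Z} (hnd : P.Nondegenerate) (hα : 0 < P.α)
    (hH : ∀ u : ImgX M N, u ≠ 0 → 0 < inner ℝ (P.H u) u) :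
    ∃ κ ≥ 0, ∀ a, ∀ y ∈ subdiff P.d a, Metric.infDist a P.dualSol ≤ κ * ‖y‖ := by
  obtain ⟨lb, hlb, hx⟩ := hnd
  have hint : ∀ x, P.dualGrad lb x = 0 → ‖lb x‖ < P.α := fun x h0 => by
    rcases hx x with h | h
    · exact absurd h0 h.2.1
    · rwa [interior_closedBall _ hα.ne', mem_ball_zero_iff] at h
  obtain ⟨C, hC, hres⟩ := P.exists_infDist_dualSol_le_residual hα hlb hint
  obtain ⟨c, hc, hcoer⟩ := exists_pos_mul_norm_sq_le_inner P.Hinv (P.inner_Hinv_pos hH)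
  -- `c` is the coercivity constant of `H⁻¹` and serves the divergence; `1 / (2 α)` comes from the
  -- growth on discs.
  set c' := min c (2 * P.α)⁻¹ with hc'
  have hc0 : 0 < c' := lt_min hc (by positivity)
  refine ⟨C ^ 2 / c', by positivity, fun a y hy => ?_⟩
  have ha := ((P.mem_subdiff_d_iff a y).1 hy).1
  obtain ⟨b, hb, hab⟩ := (P.isCompact_dualSol hα).exists_infDist_eq_dist (P.dualSol_nonempty hα) a
  have hbb := ((P.mem_dualSol_iff hα b).1 hb).1
  have hg : P.dualGrad b = P.dualGrad lb :=
    P.dualGrad_congr (P.discDiv_eq_of_mem_dualSol hα hH hb hlb)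
  have h1 := P.inner_sub_dualGrad_nonpos hH hy hbb
  have h2 := P.inner_dualGrad_sub a b (a - b)
  have h3 := hcoer (discDiv M N (a - b))
  have h4 := P.norm_pixMul_sqrt_sq_le hα hH hb ha
  have h5 : ‖residual (P.dualGrad lb) (a - lb)‖ ^ 2 ≤
      ‖discDiv M N (a - b)‖ ^ 2 + ‖pixMul (fun x => √‖P.dualGrad b x‖) (a - b)‖ ^ 2 := by
    have h6 : residual (P.dualGrad lb) (a - lb) = residual (P.dualGrad b) (a - b) := by
      rw [map_sub, ← P.residual_eq_of_mem_dualSol hα hH hb hlb, ← map_sub, hg]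
    have h7 : residual (P.dualGrad b) (a - b) =
      (discDiv M N (a - b), pixMul (fun x => √‖P.dualGrad b x‖) (a - b)) := rfl
    -- The product carries the maximum norm, whose square is at most the sum of the squares.
    rw [h6, h7, Prod.norm_mk]
    rcases max_choice ‖discDiv M N (a - b)‖ ‖pixMul (fun x => √‖P.dualGrad b x‖) (a - b)‖
      with h | h <;> rw [h]
    · exact le_add_of_nonneg_right (sq_nonneg _)
    · exact le_add_of_nonneg_left (sq_nonneg _)
  -- The subgradient inequality gives `⟨y, a - b⟩ ≥ ⟨g a, a - b⟩`, which splits into `⟨g b, a - b⟩`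
  -- plus the `H⁻¹`-energy of `Div (a - b)`.
  have h8 : c' * ‖residual (P.dualGrad lb) (a - lb)‖ ^ 2 ≤ inner ℝ y (a - b) := by
    have e1 : c' * ‖discDiv M N (a - b)‖ ^ 2 ≤ c * ‖discDiv M N (a - b)‖ ^ 2 :=
      mul_le_mul_of_nonneg_right (min_le_left _ _) (sq_nonneg _)
    have e2 : c' * ‖pixMul (fun x => √‖P.dualGrad b x‖) (a - b)‖ ^ 2 ≤
        inner ℝ (P.dualGrad b) (a - b) := by
      refine (mul_le_mul_of_nonneg_right (min_le_right _ _) (sq_nonneg _)).trans ?_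
      rw [inv_mul_le_iff₀ (by positivity)]
      exact h4
    have e3 := mul_le_mul_of_nonneg_left h5 hc0.le
    rw [← neg_sub a b, inner_neg_right, inner_sub_left] at h1
    rw [inner_sub_left] at h2
    linarith
  have h9 : inner ℝ y (a - b) ≤ ‖y‖ * Metric.infDist a P.dualSol := by
    rw [hab, dist_eq_norm]
    exact real_inner_le_norm _ _
  have h10 : Metric.infDist a P.dualSol ^ 2 ≤
      C ^ 2 * ‖residual (P.dualGrad lb) (a - lb)‖ ^ 2 := by
    rw [← mul_pow]
    exact pow_le_pow_left₀ Metric.infDist_nonneg (hres a ha) 2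
  rcases (Metric.infDist_nonneg (x := a) (s := P.dualSol)).eq_or_lt with h0 | h0
  · rw [← h0]; positivity
  · have h11 : c' * Metric.infDist a P.dualSol ^ 2 ≤
        C ^ 2 * (‖y‖ * Metric.infDist a P.dualSol) := by
      calc c' * Metric.infDist a P.dualSol ^ 2
          ≤ c' * (C ^ 2 * ‖residual (P.dualGrad lb) (a - lb)‖ ^ 2) :=
            mul_le_mul_of_nonneg_left h10 hc0.le
        _ = C ^ 2 * (c' * ‖residual (P.dualGrad lb) (a - lb)‖ ^ 2) := by ring
        _ ≤ _ := mul_le_mul_of_nonneg_left (h8.trans h9) (sq_nonneg _)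
    rw [div_mul_eq_mul_div, le_div_iff₀ hc0]
    refine le_of_mul_le_mul_right ?_ h0
    linarith

theorem Nondegenerate.exists_metricSubregularAt {P : TVData M N Z} (hnd : P.Nondegenerate)
    (hα : 0 < P.α) (hH : ∀ u : ImgX M N, u ≠ 0 → 0 < inner ℝ (P.H u) u) :
    ∃ κ, ∀ x ∈ P.dualSol, MetricSubregularAt (subdiff P.d) x 0 κ := by
  obtain ⟨κ, hκ, h⟩ := hnd.exists_infDist_le hα hH
  refine ⟨κ, fun x hx => ⟨hκ, (P.zero_mem_subdiff_d_iff hα x).2 hx, Set.univ, univ_mem,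
    Set.univ, univ_mem, fun a _ y hy => ?_⟩⟩
  simp only [P.zero_mem_subdiff_d_iff hα, dist_zero_left]
  exact h a y hy.1

/-- Contraction of the proximal step towards the solution set under an error bound. -/
theorem IsProx.infDist_le {P : TVData M N Z} (hα : 0 < P.α)
    (hH : ∀ u : ImgX M N, u ≠ 0 → 0 < inner ℝ (P.H u) u) {s κ : ℝ} (hs : 0 < s) (hκ : 0 ≤ κ)
    {lam m : ImgY M N} (h : P.IsProx s lam m)
    (hb : Metric.infDist m P.dualSol ≤ κ * ‖s⁻¹ • (lam - m)‖) :
    Metric.infDist m P.dualSol ≤ κ / √(κ ^ 2 + s ^ 2) * Metric.infDist lam P.dualSol ∧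
      ‖m - lam‖ ≤ Metric.infDist lam P.dualSol := by
  obtain ⟨b, hbS, hbd⟩ :=
    (P.isCompact_dualSol hα).exists_infDist_eq_dist (P.dualSol_nonempty hα) lam
  have h1 := h.norm_sq_add_le hα hH hs hbS
  have h2 : Metric.infDist m P.dualSol ≤ ‖m - b‖ := by
    rw [← dist_eq_norm]; exact Metric.infDist_le_dist_of_mem hbS
  rw [hbd, dist_eq_norm]
  set i := Metric.infDist m P.dualSol
  have hi : 0 ≤ i := Metric.infDist_nonneg
  refine ⟨?_, le_of_sq_le_sq (by nlinarith [sq_nonneg ‖m - b‖]) (norm_nonneg _)⟩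
  have hr : 0 < √(κ ^ 2 + s ^ 2) := Real.sqrt_pos.2 (by positivity)
  rw [div_mul_eq_mul_div, le_div_iff₀ hr]
  refine le_of_sq_le_sq ?_ (by positivity)
  rw [mul_pow, mul_pow, Real.sq_sqrt (by positivity)]
  -- Squaring and adding `κ² i² ≤ κ² ‖m - b‖²` lets the Pythagorean inequality produce `(κ² + s²) i²
  -- ≤ κ² ‖lam - b‖²`.
  have h3 : s * i ≤ κ * ‖m - lam‖ := by
    rw [norm_smul, norm_inv, Real.norm_of_nonneg hs.le, norm_sub_rev, ← mul_assoc, mul_comm κ,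
      mul_assoc, le_inv_mul_iff₀ hs] at hb
    exact hb
  have h4 := pow_le_pow_left₀ (by positivity) h3 2
  have h5 := pow_le_pow_left₀ hi h2 2
  rw [mul_pow, mul_pow] at h4
  nlinarith [mul_le_mul_of_nonneg_left h1 (sq_nonneg κ), mul_le_mul_of_nonneg_left h5 (sq_nonneg κ)]

end TVData

/-! ### Rate factor and convergence of the algorithms. -/

theorem tendsto_almRate {σ δ : ℕ → ℝ} {σinf κ : ℝ} (hσ : Tendsto σ atTop (𝓝 σinf))
    (hσinf : 0 < σinf) (hδ : Tendsto δ atTop (𝓝 0)) :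
    Tendsto (fun k => almRate κ (σ k) (δ k)) atTop (𝓝 (κ / √(κ ^ 2 + σinf ^ 2))) := by
  have h0 : √(κ ^ 2 + σinf ^ 2) ≠ 0 := (Real.sqrt_pos.2 (by positivity)).ne'
  have h1 : Tendsto (fun k => κ / √(κ ^ 2 + σ k ^ 2)) atTop (𝓝 (κ / √(κ ^ 2 + σinf ^ 2))) :=
    tendsto_const_nhds.div ((hσ.pow 2).const_add (κ ^ 2)).sqrt h0
  have h2 : Tendsto (fun k => (1 - δ k)⁻¹) atTop (𝓝 (1 - 0)⁻¹) :=
    (hδ.const_sub 1).inv₀ (by norm_num)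
  simpa [almRate] using (h1.add hδ).mul h2

theorem div_sqrt_sq_add_sq_lt_one {κ s : ℝ} (hs : 0 < s) : κ / √(κ ^ 2 + s ^ 2) < 1 := by
  rw [div_lt_one (Real.sqrt_pos.2 (by positivity))]
  exact Real.lt_sqrt_of_sq_lt (by nlinarith)

namespace TVData

variable {M N : ℕ} {Z : Type*} [NormedAddCommGroup Z] [InnerProductSpace ℝ Z]
  [FiniteDimensional ℝ Z]

-- Expresses `p` through `∇u` and the multiplier increment, so that `p` inherits convergence from
-- `u` and `lam`.
omit [FiniteDimensional ℝ Z] in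
theorem pOf_eq_grad_sub (P : TVData M N Z) (hα : 0 < P.α) {s : ℝ} (hs : 0 < s) (lam : ImgY M N)
    (u : ImgX M N) :
    P.pOf s lam u = grad M N u - s⁻¹ • (isoProj P.α (lam + s • grad M N u) - lam) := by
  have h := P.pOf_eq hα hs lam u
  have h1 : isoProj P.α (lam + s • grad M N u) - lam = s • (grad M N u - P.pOf s lam u) := by
    rw [smul_sub, sub_eq_sub_iff_add_eq_add, ← h, add_comm]
  rw [h1, inv_smul_smul₀ hs.ne', sub_sub_cancel]

/-- All three methods update `p` and `lam` in the same way. -/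
theorem update_of_isALM (P : TVData M N Z) (hα : 0 < P.α) {σ : ℕ → ℝ} (hσ : ∀ k, 0 < σ k)
    {tol : ℕ → ℕ → ℝ} {u : ℕ → ImgX M N} {p lam : ℕ → ImgY M N}
    (hgen : P.IsALMPDP σ tol u p lam ∨ P.IsALMPDD σ tol u p lam ∨ P.IsALMPT σ tol u p lam)
    (k : ℕ) :
    p (k + 1) = P.pOf (σ k) (lam k) (u (k + 1)) ∧
      lam (k + 1) = isoProj P.α (lam k + σ k • grad M N (u (k + 1))) := by
  rcases hgen with h | h | ⟨m, -, ϑ, -, h⟩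
  · exact (h k).2
  · exact (h k).2
  · refine ⟨(h k).2.1, ?_⟩
    rw [(h k).2.2, (h k).2.1, smul_sub, ← add_sub_assoc, sub_eq_iff_eq_add]
    exact P.pOf_eq hα (hσ k) _ _

/-- Drop the energy term from the gap estimate. Used with `e = ε k` for (A) and `e = δ k ‖lam (k +
1) - lam k‖` for (B1). -/
theorem IsProx.norm_isoProj_sub_le {P : TVData M N Z} (hα : 0 < P.α)
    (hH : ∀ u : ImgX M N, u ≠ 0 → 0 < inner ℝ (P.H u) u) {s : ℝ} (hs : 0 < s)
    {lam m : ImgY M N} (h : P.IsProx s lam m) (u : ImgX M N) {e : ℝ} (he : 0 ≤ e)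
    (hgap : P.Phi s lam u - ⨅ v, P.Phi s lam v ≤ e ^ 2 / (2 * s)) :
    ‖isoProj P.α (lam + s • grad M N u) - m‖ ≤ e := by
  have h1 := h.gap_le hα hH hs u
  have h2 := P.inner_H_nonneg hH (u - P.Hinv (discDiv M N m + P.f))
  refine le_of_sq_le_sq ?_ he
  have h3 : ‖isoProj P.α (lam + s • grad M N u) - m‖ ^ 2 / (2 * s) ≤ e ^ 2 / (2 * s) := by linarith
  exact (div_le_div_iff_of_pos_right (by positivity)).1 h3

/-- Limits of proximal points with vanishing steps are dual solutions. -/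
theorem mem_dualSol_of_tendsto_isProx (P : TVData M N Z) (hα : 0 < P.α)
    (hH : ∀ u : ImgX M N, u ≠ 0 → 0 < inner ℝ (P.H u) u) {σ : ℕ → ℝ} {σinf : ℝ}
    (hσinf : 0 < σinf) (hσ : Tendsto σ atTop (𝓝 σinf)) {lam m : ℕ → ImgY M N}
    (hm : ∀ k, P.IsProx (σ k) (lam k) (m k))
    (h0 : Tendsto (fun k => m k - lam k) atTop (𝓝 0)) {φ : ℕ → ℕ} (hφ : StrictMono φ)
    {s : ImgY M N} (hs : s ∈ isoBall M N P.α) (hlim : Tendsto (m ∘ φ) atTop (𝓝 s)) :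
    s ∈ P.dualSol := by
  refine P.mem_dualSol_of_inner_nonneg hα hH hs fun v hv => ?_
  have hlim' : Tendsto (fun k => m (φ k)) atTop (𝓝 s) := hlim
  have h1 : Tendsto (fun k => (σ k)⁻¹ • (m k - lam k)) atTop (𝓝 0) := by
    simpa using (hσ.inv₀ hσinf.ne').smul h0
  have h2 : Tendsto (fun k => P.dualGrad (m (φ k)) + (σ (φ k))⁻¹ • (m (φ k) - lam (φ k))) atTop
      (𝓝 (P.dualGrad s + 0)) :=
    ((P.continuous_dualGrad.tendsto s).comp hlim').add (h1.comp hφ.tendsto_atTop)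
  have h3 := h2.inner (𝕜 := ℝ) (hlim'.const_sub v)
  rw [add_zero] at h3
  exact ge_of_tendsto' h3 fun k => (hm (φ k)).2 v hv

/-- Convergence of the primal iterates. -/
theorem tendsto_primal_of_tendsto_isProx (P : TVData M N Z) (hα : 0 < P.α)
    (hH : ∀ u : ImgX M N, u ≠ 0 → 0 < inner ℝ (P.H u) u) {σ : ℕ → ℝ} {σinf : ℝ}
    (hσpos : ∀ k, 0 < σ k) (hσinf : 0 < σinf) (hσ : Tendsto σ atTop (𝓝 σinf))
    {lam m : ℕ → ImgY M N} (hm : ∀ k, P.IsProx (σ k) (lam k) (m k)) {u : ℕ → ImgX M N}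
    {ε : ℕ → ℝ} (hε : Tendsto ε atTop (𝓝 0))
    (hgap : ∀ k, P.Phi (σ k) (lam k) (u (k + 1)) - ⨅ v, P.Phi (σ k) (lam k) v ≤
      ε k ^ 2 / (2 * σ k)) {s : ImgY M N} (hs : Tendsto m atTop (𝓝 s)) :
    Tendsto u atTop (𝓝 (P.Hinv (discDiv M N s + P.f))) := by
  obtain ⟨c, hc, hcoer⟩ := exists_pos_mul_norm_sq_le_inner P.H hH
  -- The gap bound concerns `u (k + 1)`; `u 0` is arbitrary.
  rw [← tendsto_add_atTop_iff_nat 1]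
  have hw : Tendsto (fun k => P.Hinv (discDiv M N (m k) + P.f)) atTop
      (𝓝 (P.Hinv (discDiv M N s + P.f))) := by
    have hcont : Continuous fun a : ImgY M N => P.Hinv (discDiv M N a + P.f) :=
      (continuous_linearMap P.Hinv).comp
        ((continuous_linearMap (discDiv M N)).add continuous_const)
    exact (hcont.tendsto s).comp hs
  have hsq : Tendsto (fun k => ‖u (k + 1) - P.Hinv (discDiv M N (m k) + P.f)‖ ^ 2) atTop
      (𝓝 0) := by
    refine squeeze_zero (fun k => sq_nonneg _) (g := fun k => 2 / c * (ε k ^ 2 / (2 * σ k)))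
      (fun k => ?_) ?_
    · have h1 := (hm k).gap_le hα hH (hσpos k) (u (k + 1))
      have h2 := hcoer (u (k + 1) - P.Hinv (discDiv M N (m k) + P.f))
      have h3 : 0 ≤ ‖isoProj P.α (lam k + σ k • grad M N (u (k + 1))) - m k‖ ^ 2 / (2 * σ k) :=
        div_nonneg (sq_nonneg _) (by linarith [hσpos k])
      rw [div_mul_eq_mul_div, le_div_iff₀ hc]
      linarith [hgap k]
    · simpa using ((hε.pow 2).div (hσ.const_mul 2) (by positivity)).const_mul (2 / c)
  have hdiff : Tendsto (fun k => u (k + 1) - P.Hinv (discDiv M N (m k) + P.f)) atTop (𝓝 0) := by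
    rw [tendsto_zero_iff_norm_tendsto_zero]
    simpa using hsq.sqrt
  simpa using hdiff.add hw

/-- Eventual linear rate of the multiplier iterates. -/
theorem eventually_infDist_le_almRate (P : TVData M N Z) (hα : 0 < P.α)
    (hH : ∀ u : ImgX M N, u ≠ 0 → 0 < inner ℝ (P.H u) u) {σ : ℕ → ℝ} {σinf : ℝ}
    (hσpos : ∀ k, 0 < σ k) (hσinf : 0 < σinf) (hσ : Tendsto σ atTop (𝓝 σinf))
    {lam m : ℕ → ImgY M N} (hm : ∀ k, P.IsProx (σ k) (lam k) (m k)) {s : ImgY M N}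
    (hlams : Tendsto lam atTop (𝓝 s)) (hms : Tendsto m atTop (𝓝 s)) {δ : ℕ → ℝ}
    (hδ0 : ∀ k, 0 ≤ δ k) (hδ : Tendsto δ atTop (𝓝 0))
    (hstep : ∀ k, ‖lam (k + 1) - m k‖ ≤ δ k * ‖lam (k + 1) - lam k‖) {κ : ℝ}
    (hsub : MetricSubregularAt (subdiff P.d) s 0 κ) :
    ∀ᶠ k in atTop, Metric.infDist (lam (k + 1)) P.dualSol ≤
      almRate κ (σ k) (δ k) * Metric.infDist (lam k) P.dualSol := by
  obtain ⟨hκ, -, U, hU, V, hV, hUV⟩ := hsub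
  simp only [P.zero_mem_subdiff_d_iff hα, dist_zero_left] at hUV
  have hg : Tendsto (fun k => (σ k)⁻¹ • (lam k - m k)) atTop (𝓝 0) := by
    simpa using (hσ.inv₀ hσinf.ne').smul (hlams.sub hms)
  filter_upwards [hms hU, hg hV, hδ.eventually_lt_const one_pos] with k hkU hkV hδ1
  obtain ⟨h1, h2⟩ := (hm k).infDist_le hα hH (hσpos k) hκ
    (hUV (m k) hkU _ ⟨(hm k).mem_subdiff hH, hkV⟩)
  set I := Metric.infDist (lam k) P.dualSol
  have hI : 0 ≤ I := Metric.infDist_nonneg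
  have hδ' : 0 < 1 - δ k := sub_pos.2 hδ1
  -- The triangle inequality through `m k` bounds the increment by `I` plus `δ k` times itself,
  -- which is absorbed once `δ k < 1`.
  have h3 : ‖lam (k + 1) - lam k‖ ≤ I * (1 - δ k)⁻¹ := by
    rw [← div_eq_mul_inv, le_div_iff₀ hδ']
    have h4 := norm_add_le (lam (k + 1) - m k) (m k - lam k)
    rw [sub_add_sub_cancel] at h4
    linarith [hstep k]
  have h5 : Metric.infDist (lam (k + 1)) P.dualSol ≤
      Metric.infDist (m k) P.dualSol + ‖lam (k + 1) - m k‖ := by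
    rw [← dist_eq_norm]; exact Metric.infDist_le_infDist_add_dist
  have h6 := mul_le_mul_of_nonneg_left h3 (hδ0 k)
  have h7 : κ / √(κ ^ 2 + σ k ^ 2) * I ≤ κ / √(κ ^ 2 + σ k ^ 2) * I * (1 - δ k)⁻¹ :=
    le_mul_of_one_le_right (by positivity) ((one_le_inv₀ hδ').2 (by linarith [hδ0 k]))
  have h8 : almRate κ (σ k) (δ k) * I =
      κ / √(κ ^ 2 + σ k ^ 2) * I * (1 - δ k)⁻¹ + δ k * (I * (1 - δ k)⁻¹) := by
    rw [almRate]; ring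
  linarith [hstep k]

end TVData

theorem mainTheorem4 {M N : ℕ} {Z : Type*} [NormedAddCommGroup Z] [InnerProductSpace ℝ Z]
    [FiniteDimensional ℝ Z] (P : TVData M N Z) (hμ : 0 ≤ P.μ) (hα : 0 < P.α)
    (hH : ∀ u : ImgX M N, u ≠ 0 → 0 < inner ℝ (P.H u) u)
    (σ : ℕ → ℝ) (σinf : ℝ) (hσ0 : 0 < σ 0) (hσ : Monotone σ)
    (hσlim : Tendsto σ atTop (𝓝 σinf)) (tol : ℕ → ℕ → ℝ)
    (u : ℕ → ImgX M N) (p lam : ℕ → ImgY M N)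
    (hgen : P.IsALMPDP σ tol u p lam ∨ P.IsALMPDD σ tol u p lam ∨ P.IsALMPT σ tol u p lam)
    (ε : ℕ → ℝ) (hA : P.CritA σ ε u lam) :
    Bornology.IsBounded (Set.range fun k => (u k, p k, lam k)) ∧
    ∃ (us : ImgX M N) (ps ls : ImgY M N),
      (∀ v, P.primal us ≤ P.primal v) ∧ ps = grad M N us ∧ ls ∈ P.dualSol ∧
      Tendsto (fun k => (u k, p k, lam k)) atTop (𝓝 (us, ps, ls)) ∧
      (P.Nondegenerate →
        (∃ κ, ∀ x ∈ P.dualSol, MetricSubregularAt (subdiff P.d) x 0 κ) ∧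
        ∀ δ : ℕ → ℝ, P.CritB1 σ δ u lam →
          ∀ κd : ℝ, MetricSubregularAt (subdiff P.d) ls 0 κd →
            (∀ᶠ k in atTop, Metric.infDist (lam (k + 1)) P.dualSol ≤
              almRate κd (σ k) (δ k) * Metric.infDist (lam k) P.dualSol) ∧
            Tendsto (fun k => almRate κd (σ k) (δ k)) atTop
              (𝓝 (κd / √(κd ^ 2 + σinf ^ 2))) ∧
            κd / √(κd ^ 2 + σinf ^ 2) < 1) := by
  have hσpos : ∀ k, 0 < σ k := fun k => hσ0.trans_le (hσ (Nat.zero_le k))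
  have hσinf : 0 < σinf := hσ0.trans_le (hσ.ge_of_tendsto hσlim 0)
  have hupd := P.update_of_isALM hα hσpos hgen
  obtain ⟨hε0, hε, hgap⟩ := hA
  choose m hm using fun k => P.exists_isProx hα hH (σ k) (lam k)
  obtain ⟨ls, hls, hlam, hml⟩ := exists_tendsto_of_quasiFejer (isCompact_isoBall P.α)
    (P.dualSol_nonempty hα) hε0 hε (fun k => (hm k).1)
    (fun k s hs => (hm k).norm_sq_add_le hα hH (hσpos k) hs)
    (fun k => by
      rw [(hupd k).2]
      exact (hm k).norm_isoProj_sub_le hα hH (hσpos k) _ (hε0 k) (hgap k))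
    (fun h0 φ s hφ hs hlim =>
      P.mem_dualSol_of_tendsto_isProx hα hH hσinf hσlim hm h0 hφ hs hlim)
  have hu := P.tendsto_primal_of_tendsto_isProx hα hH hσpos hσinf hσlim hm
    hε.tendsto_atTop_zero hgap hml
  set us := P.Hinv (discDiv M N ls + P.f)
  have hp : Tendsto p atTop (𝓝 (grad M N us)) := by
    rw [← tendsto_add_atTop_iff_nat 1]
    have h1 : ∀ k, p (k + 1) = grad M N (u (k + 1)) - (σ k)⁻¹ • (lam (k + 1) - lam k) :=
      fun k => by rw [(hupd k).1, P.pOf_eq_grad_sub hα (hσpos k), (hupd k).2]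
    have h2 : Tendsto (fun k => grad M N (u (k + 1))) atTop (𝓝 (grad M N us)) :=
      ((continuous_linearMap (grad M N)).tendsto us).comp ((tendsto_add_atTop_iff_nat 1).2 hu)
    have h3 := h2.sub
      ((hσlim.inv₀ hσinf.ne').smul (((tendsto_add_atTop_iff_nat 1).2 hlam).sub hlam))
    simpa [h1] using h3
  have hall := hu.prodMk_nhds (hp.prodMk_nhds hlam)
  refine ⟨Metric.isBounded_range_of_tendsto _ hall, us, grad M N us, ls,
    P.primal_le_of_mem_dualSol hα hH hls, rfl, hls, hall, fun hnd =>
    ⟨hnd.exists_metricSubregularAt hα hH, ?_⟩⟩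
  rintro δ ⟨hδ0, hδ, hB⟩ κd hsub
  refine ⟨P.eventually_infDist_le_almRate hα hH hσpos hσinf hσlim hm hlam hml hδ0
    hδ.tendsto_atTop_zero (fun k => ?_) hsub, tendsto_almRate hσlim hσinf hδ.tendsto_atTop_zero,
    div_sqrt_sq_add_sq_lt_one hσinf⟩
  have h1 := (hm k).norm_isoProj_sub_le hα hH (hσpos k) (u (k + 1))
    (mul_nonneg (hδ0 k) (norm_nonneg (lam (k + 1) - lam k)))
    ((hB k).trans_eq (by rw [mul_pow, div_mul_eq_mul_div]))
  rwa [← (hupd k).2] at h1
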